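/- Let $C=\mathbb R+e\mathbb R$, $e^2=1$, be the algebra of para-complex numbers. Let $M$ be a para-complex manifold of para-complex dimension $m\ge 3$: a smooth manifold of real dimension $2m$ with a smooth field $I$ of endomorphisms of $TM$ such that $I^2=\mathrm{Id}$, $I\ne\pm\mathrm{Id}$, and the eigendistributions $T^{\pm}M=\ker(\mathrm{Id}\mp I)$ have equal rank and are integrable. Para-holomorphic coordinates are smooth coordinates $z^a=x^a+ey^a$ ($a=1,\dots,m$) with $I\partial_{x^a}=\partial_{y^a}$, $I\partial_{y^a}=\partial_{x^a}$; put $\partial_a=\tfrac12(\partial_{x^a}+e\,\partial_{y^a})$, $\partial_{\bar a}=\tfrac12(\partial_{x^a}-e\,\partial_{y^a})$. Capital indices run over $1,\dots,m,\bar 1,\dots,\bar m$, small ones over $1,\dots,m$. Let $G$ be a para-complex Riemannian metric on $M$, i.e. a smooth symmetric non-degenerate $C$-bilinear form on $T_CM=TM\otimes_{\mathbb R}C$ with $G(\bar Z_1,\bar Z_2)=\overline{G(Z_1,Z_2)}$ and $G(Z_1,Z_2)=0$ whenever $IZ_1=eZ_1$, $IZ_2=-eZ_2$. Write $G_{AB}=G(\partial_A,\partial_B)$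 and $(G^{AB})=(G_{AB})^{-1}$. Let $D$, $D_{\partial_A}\partial_B=L^C_{AB}\partial_C$, be the characteristic connection of $(M,G)$, that is, the unique symmetric linear connection with $DI=0$ and $D_aG_{bc}=0$; explicitly $$L^C_{AB}=\Gamma^C_{AB}+\tfrac12\Phi^C_{AB}-\tfrac12G^{CE}(\Psi_{EA,B}+\Psi_{EB,A}),$$ where $\Gamma$ and $\widetilde\Gamma$ are the Christoffel symbols of $G$ and of the twin metric $\widetilde G(Z_1,Z_2)=G(IZ_1,Z_2)$, $\Phi=\widetilde\Gamma-\Gamma$ and $\Psi_{AB,C}=\Phi^E_{AB}G_{EC}$. Let $R(X,Y)Z=[D_X,D_Y]Z-D_{[X,Y]}Z$, $R(\partial_A,\partial_B)\partial_C=R^E_{C,AB}\,\partial_E$, be its curvature and $\mathrm{Ric}_{CA}=R^B_{C,AB}$ its Ricci tensor. Assume that $(M,G)$ is characteristic Einstein: there is a function $f:M\to C$ such that $\mathrm{Ric}_{c\bar a}=0$ and $\mathrm{Ric}_{ca}=f\,G_{ca}$ for all $a,c\in\{1,\dots,m\}$, in all para-holomorphic coordinates. Then the characteristic scalar curvature $\rho_0=G^{ca}\mathrm{Ric}_{ca}$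 (sum over $a,c\in\{1,\dots,m\}$), which is a well-defined function $M\to C$ independent of the para-holomorphic coordinates, is anti-para-holomorphic, i.e. smooth with $d\rho_0\circ I=-e\,d\rho_0$, and $\mathrm{Ric}_{ca}=\frac{\rho_0}{m}\,G_{ca}$ for all $a,c$ in all para-holomorphic coordinates. -/

import Mathlib

open scoped Manifold ContDiff TensorProduct

/- Give the standard charted space structure of the model space precedence in instance search. -/
attribute [instance 2000] chartedSpaceSelf

noncomputable section

namespace ParaGeom

/-! ### The algebra of para-complex numbers -/

/-- The algebra `C = ℝ + e ℝ`, `e² = 1`, of para-complex numbers; the product is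
`(x₁ + e y₁)(x₂ + e y₂) = (x₁ x₂ + y₁ y₂) + e (x₁ y₂ + y₁ x₂)` and `star` is the
conjugation `x + e y ↦ x - e y`. -/
abbrev ParaComplex : Type := QuadraticAlgebra ℝ 1 0

namespace ParaComplex

/-- The para-complex unit. -/
def e : ParaComplex := ⟨0, 1⟩

theorem e_mul_e : e * e = 1 := by
  ext <;> simp [e, QuadraticAlgebra.re_one, QuadraticAlgebra.im_one]

theorem mul_def' (z w : ParaComplex) :
    z * w = ⟨z.re * w.re + z.im * w.im, z.re * w.im + z.im * w.re⟩ := by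
  ext <;> simp

theorem star_def' (z : ParaComplex) : star z = ⟨z.re, -z.im⟩ := by
  ext <;> simp

/-- The identification `C = ℝ × ℝ`. -/
def toProd : ParaComplex →ₗ[ℝ] ℝ × ℝ where
  toFun z := (z.re, z.im)
  map_add' _ _ := rfl
  map_smul' _ _ := rfl

theorem toProd_injective : Function.Injective toProd := by
  intro z w h
  exact QuadraticAlgebra.ext (congrArg Prod.fst h) (congrArg Prod.snd h)

/-- `C` with its usual topology, that of `ℝ × ℝ`. -/
instance : NormedAddCommGroup ParaComplex :=
  NormedAddCommGroup.induced ParaComplex (ℝ × ℝ) toProd toProd_injective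

instance : NormedSpace ℝ ParaComplex :=
  NormedSpace.induced ℝ ParaComplex (ℝ × ℝ) toProd

/-- Conjugation as a real linear map. -/
def conjₗ : ParaComplex →ₗ[ℝ] ParaComplex where
  toFun z := star z
  map_add' z w := star_add z w
  map_smul' r z := by ext <;> simp

end ParaComplex

open ParaComplex

/-- The real `2m`-dimensional model space, identified with `C^m`. As a real normed space it
is just `ℝ^{2m}`. -/
abbrev Model (m : ℕ) : Type := Fin m → ParaComplex

/-- The indices `A ∈ {1, …, m, 1̄, …, m̄}`: `Sum.inl a` is `a` and `Sum.inr a` is `ā`. -/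
abbrev Idx (m : ℕ) : Type := Fin m ⊕ Fin m

variable {m : ℕ} {M : Type*} [TopologicalSpace M] [ChartedSpace (Model m) M]

/-! ### Para-complex manifolds -/

/-- The real tangent space `T_p M` of the smooth `2m`-dimensional manifold `M`. -/
abbrev RealTangent (m : ℕ) {M : Type*} [TopologicalSpace M] [ChartedSpace (Model m) M]
    (p : M) : Type :=
  TangentSpace 𝓘(ℝ, Model m) p

/-- The smooth charts of `M` (elements of the maximal smooth atlas), as real charts. -/
abbrev smoothCharts (m : ℕ) (M : Type*) [TopologicalSpace M] [ChartedSpace (Model m) M] :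
    Set (OpenPartialHomeomorph M (Model m)) :=
  IsManifold.maximalAtlas 𝓘(ℝ, Model m) ∞ M

/-- For a chart `φ`, a point `x` of its target and a vector `v` of the model space, the value at
`φ⁻¹(x)` of the coordinate vector field of `φ` with constant components `v`. -/
def coordVec (φ : OpenPartialHomeomorph M (Model m)) (x v : Model m) :
    RealTangent m (φ.symm x) :=
  mfderiv 𝓘(ℝ, Model m) 𝓘(ℝ, Model m) φ.symm x v

/-- A distribution `𝒟 ⊆ TM` is integrable if every point has a flat chart, i.e. a smooth chart
`φ` around it in which `𝒟` is spanned by coordinate vector fields (up to a fixed linear change of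
coordinates: `dφ` maps each `𝒟_q` onto one and the same subspace `F`). -/
def IsIntegrableDistribution (𝒟 : ∀ p : M, Submodule ℝ (RealTangent m p)) : Prop :=
  ∀ p : M, ∃ φ ∈ smoothCharts m M, p ∈ φ.source ∧ ∃ F : Submodule ℝ (Model m),
    ∀ x ∈ φ.target, ∀ v : Model m, coordVec φ x v ∈ 𝒟 (φ.symm x) ↔ v ∈ F

/-- A para-complex structure on the smooth `2m`-dimensional manifold `M`: a smooth field `I` of
endomorphisms of `TM` with `I² = Id`, `I ≠ ± Id`, whose eigenspaces for the eigenvalues `± 1` have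
the same dimension at every point and form integrable distributions `T^± M`. -/
structure ParaComplexStructure (m : ℕ) (M : Type*) [TopologicalSpace M]
    [ChartedSpace (Model m) M] [IsManifold 𝓘(ℝ, Model m) ∞ M] where
  /-- the endomorphism field -/
  I : ∀ p : M, RealTangent m p →L[ℝ] RealTangent m p
  smooth_I : ContMDiff 𝓘(ℝ, Model m) (𝓘(ℝ, Model m).prod 𝓘(ℝ, Model m →L[ℝ] Model m)) ∞
    (fun p : M ↦ (Bundle.TotalSpace.mk' (Model m →L[ℝ] Model m) p (I p) :
      Bundle.TotalSpace (Model m →L[ℝ] Model m)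
        (fun p : M ↦ RealTangent m p →L[ℝ] RealTangent m p)))
  sq : ∀ p v, I p (I p v) = v
  ne_id : ∀ p, I p ≠ ContinuousLinearMap.id ℝ _
  ne_neg_id : ∀ p, I p ≠ -ContinuousLinearMap.id ℝ _
  finrank_eq : ∀ p,
    Module.finrank ℝ (LinearMap.ker (LinearMap.id - (I p : RealTangent m p →ₗ[ℝ] _))) =
      Module.finrank ℝ (LinearMap.ker (LinearMap.id + (I p : RealTangent m p →ₗ[ℝ] _)))
  integrable_plus : IsIntegrableDistribution
    (fun p ↦ LinearMap.ker (LinearMap.id - (I p : RealTangent m p →ₗ[ℝ] _)))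
  integrable_minus : IsIntegrableDistribution
    (fun p ↦ LinearMap.ker (LinearMap.id + (I p : RealTangent m p →ₗ[ℝ] _)))

variable [IsManifold 𝓘(ℝ, Model m) ∞ M]

/-- The smooth chart `φ = (z^1, …, z^m)`, `z^a = x^a + e y^a`, is a para-holomorphic coordinate
system: `I (∂/∂x^a) = ∂/∂y^a` and `I (∂/∂y^a) = ∂/∂x^a`, i.e. `dφ ∘ I = e dφ`. -/
def IsParaHolomorphicChart (J : ParaComplexStructure m M)
    (φ : OpenPartialHomeomorph M (Model m)) : Prop :=
  φ ∈ smoothCharts m M ∧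
    ∀ x ∈ φ.target, ∀ v : Model m, J.I (φ.symm x) (coordVec φ x v) = coordVec φ x (e • v)

/-- The differential `dh_p : T_p M → C` of a para-complex function `h` on `M`. -/
def dfun (h : M → ParaComplex) (p : M) (v : RealTangent m p) : ParaComplex :=
  mfderiv 𝓘(ℝ, Model m) 𝓘(ℝ, ParaComplex) h p v

/-- A para-complex function `h` on `M` is anti-para-holomorphic: it is smooth and
`dh ∘ I = - e dh`. -/
def IsAntiParaHolomorphic (J : ParaComplexStructure m M) (h : M → ParaComplex) : Prop :=
  ContMDiff 𝓘(ℝ, Model m) 𝓘(ℝ, ParaComplex) ∞ h ∧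
    ∀ (p : M) (v : RealTangent m p),
      dfun h p (J.I p v) = -(e * dfun h p v)

/-! ### The para-complexified tangent bundle and para-complex Riemannian metrics -/

/-- The para-complexified tangent space `T_{p,C} M = T_p M ⊗ C`. -/
abbrev CTangent (m : ℕ) {M : Type*} [TopologicalSpace M] [ChartedSpace (Model m) M]
    (p : M) : Type :=
  ParaComplex ⊗[ℝ] RealTangent m p

/-- Conjugation of `T_{p,C} M`. -/
def conjT (p : M) : CTangent m p →ₗ[ℝ] CTangent m p :=
  conjₗ.rTensor (RealTangent m p)

/-- The `C`-linear extension of `I` to `T_{p,C} M`. -/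
def IC (J : ParaComplexStructure m M) (p : M) : CTangent m p →ₗ[ParaComplex] CTangent m p :=
  LinearMap.baseChange ParaComplex (J.I p : RealTangent m p →ₗ[ℝ] RealTangent m p)

/-- A para-complex Riemannian metric: a smooth `C`-bilinear symmetric nondegenerate `2`-tensor field
`G` on `T_C M`, compatible with conjugation and with `G (T^{1,0}, T^{0,1}) = 0`, where `T^{1,0}` and
`T^{0,1}` are the eigenspaces of `I` for `e` and `-e`. -/
structure ParaComplexRiemannianMetric (J : ParaComplexStructure m M) where
  /-- the bilinear form at each point -/
  G : ∀ p : M, LinearMap.BilinForm ParaComplex (CTangent m p)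
  symm : ∀ p Z₁ Z₂, G p Z₁ Z₂ = G p Z₂ Z₁
  nondegenerate : ∀ p, (G p).Nondegenerate
  conj : ∀ p Z₁ Z₂, G p (conjT p Z₁) (conjT p Z₂) = star (G p Z₁ Z₂)
  orth : ∀ p Z₁ Z₂, IC J p Z₁ = e • Z₁ → IC J p Z₂ = -(e • Z₂) → G p Z₁ Z₂ = 0
  smooth : ∀ φ ∈ smoothCharts m M, ∀ v w : Model m,
    ContDiffOn ℝ ∞ (fun x ↦ G (φ.symm x) (1 ⊗ₜ coordVec φ x v) (1 ⊗ₜ coordVec φ x w)) φ.target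

/-! ### Local expressions in a para-holomorphic coordinate system

Local components are functions of the coordinate `x` in the target of the chart. -/

/-- `∂/∂x^a` in the model space. -/
def dirX (a : Fin m) : Model m := Pi.single a 1

/-- `∂/∂y^a` in the model space. -/
def dirY (a : Fin m) : Model m := Pi.single a e

/-- The vectors `∂/∂z^a = (∂/∂x^a + e ∂/∂y^a)/2` and `∂/∂z^ā = (∂/∂x^a - e ∂/∂y^a)/2` of
`T_C M`. -/
def coordC (φ : OpenPartialHomeomorph M (Model m)) (x : Model m) :
    Idx m → CTangent m (φ.symm x)
  | Sum.inl a => (1 / 2 : ℝ) • ((1 : ParaComplex) ⊗ₜ[ℝ] coordVec φ x (dirX a) +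
      e ⊗ₜ[ℝ] coordVec φ x (dirY a))
  | Sum.inr a => (1 / 2 : ℝ) • ((1 : ParaComplex) ⊗ₜ[ℝ] coordVec φ x (dirX a) -
      e ⊗ₜ[ℝ] coordVec φ x (dirY a))

/-- The derivatives `∂h/∂z^A` of a para-complex function of the coordinates. -/
def pd (h : Model m → ParaComplex) : Idx m → Model m → ParaComplex
  | Sum.inl a => fun x ↦ (1 / 2 : ℝ) • (fderiv ℝ h x (dirX a) + e * fderiv ℝ h x (dirY a))
  | Sum.inr a => fun x ↦ (1 / 2 : ℝ) • (fderiv ℝ h x (dirX a) - e * fderiv ℝ h x (dirY a))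

/-- The Christoffel symbols `Γ^C_{AB}` of a matrix-valued function `(g_{AB})`:
`Γ^C_{AB} = ½ g^{CD} (∂_A g_{BD} + ∂_B g_{AD} - ∂_D g_{AB})`. -/
def christoffel (g : Model m → Matrix (Idx m) (Idx m) ParaComplex) (C A B : Idx m)
    (x : Model m) : ParaComplex :=
  (1 / 2 : ℝ) • ∑ D, (g x)⁻¹ C D *
    (pd (fun y ↦ g y B D) A x + pd (fun y ↦ g y A D) B x - pd (fun y ↦ g y A B) D x)

variable {J : ParaComplexStructure m M} (G : ParaComplexRiemannianMetric J)
  (φ : OpenPartialHomeomorph M (Model m))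

/-- The components `G_{AB} = G(∂/∂z^A, ∂/∂z^B)`. -/
def localG (x : Model m) : Matrix (Idx m) (Idx m) ParaComplex :=
  fun A B ↦ G.G (φ.symm x) (coordC φ x A) (coordC φ x B)

/-- The components of the twin metric `G̃(Z₁, Z₂) = G(I Z₁, Z₂)`. -/
def localTwin (x : Model m) : Matrix (Idx m) (Idx m) ParaComplex :=
  fun A B ↦ G.G (φ.symm x) (IC J (φ.symm x) (coordC φ x A)) (coordC φ x B)

/-- The components `Φ^C_{AB}` of the fundamental tensor `Φ`, the difference between the Levi-Civita
connections of the twin metric and of `G`. -/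
def fundPhi (C A B : Idx m) (x : Model m) : ParaComplex :=
  christoffel (localTwin G φ) C A B x - christoffel (localG G φ) C A B x

/-- The components `Ψ_{AB,C} = Φ^D_{AB} G_{DC}`. -/
def fundPsi (A B C : Idx m) (x : Model m) : ParaComplex :=
  ∑ D, fundPhi G φ D A B x * localG G φ x D C

/-- The coefficients `L^C_{AB}` of the characteristic connection `D`, with
`D_{∂_A} ∂_B = L^C_{AB} ∂_C`:
`L^C_{AB} = Γ^C_{AB} + ½ Φ^C_{AB} - ½ G^{CD} (Ψ_{DA,B} + Ψ_{DB,A})`.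
This `D` is the unique symmetric connection with `D I = 0` and `D_a G_{bc} = 0`. -/
def charConn (C A B : Idx m) (x : Model m) : ParaComplex :=
  christoffel (localG G φ) C A B x + (1 / 2 : ℝ) • fundPhi G φ C A B x -
    (1 / 2 : ℝ) • ∑ D, (localG G φ x)⁻¹ C D * (fundPsi G φ D A B x + fundPsi G φ D B A x)

/-- The components `R^D_{C,AB}` of the curvature tensor of the characteristic connection:
`R(∂_A, ∂_B) ∂_C = R^D_{C,AB} ∂_D` with `R(X, Y) Z = [D_X, D_Y] Z - D_{[X,Y]} Z`. -/
def charCurv (D C A B : Idx m) (x : Model m) : ParaComplex :=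
  pd (charConn G φ D B C) A x - pd (charConn G φ D A C) B x +
    ∑ F, (charConn G φ F B C x * charConn G φ D A F x -
      charConn G φ F A C x * charConn G φ D B F x)

/-- The components `Ric_{CA} = R^B_{C,AB}` of the characteristic Ricci tensor. -/
def charRic (C A : Idx m) (x : Model m) : ParaComplex :=
  ∑ B, charCurv G φ B C A B x

/-- The local expression `G^{ca} Ric_{ca}`, summed over the unbarred indices. -/
def localScal (x : Model m) : ParaComplex :=
  ∑ c : Fin m, ∑ a : Fin m,
    (localG G φ x)⁻¹ (Sum.inl c) (Sum.inl a) * charRic G φ (Sum.inl c) (Sum.inl a) x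

open Classical in
/-- The characteristic scalar curvature `ρ₀ = G^{ca} Ric_{ca} : M → C`, computed in any
para-holomorphic coordinate system around the point (one exists at every point since the
distributions `T^± M` are integrable). -/
def charScal (p : M) : ParaComplex :=
  if h : ∃ φ : OpenPartialHomeomorph M (Model m), IsParaHolomorphicChart J φ ∧ p ∈ φ.source then
    localScal G h.choose (h.choose p)
  else 0

/-- `(M, G)` is characteristic Einstein: there is a para-complex valued function `f` on `M` such
that in all para-holomorphic coordinates `Ric_{cā} = 0` and `Ric_{ca} = f G_{ca}`. -/
def IsCharacteristicEinstein : Prop :=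
  ∃ f : M → ParaComplex, ∀ φ : OpenPartialHomeomorph M (Model m), IsParaHolomorphicChart J φ →
    ∀ x ∈ φ.target, ∀ c a : Fin m,
      charRic G φ (Sum.inl c) (Sum.inr a) x = 0 ∧
      charRic G φ (Sum.inl c) (Sum.inl a) x =
        f (φ.symm x) * localG G φ x (Sum.inl c) (Sum.inl a)

end ParaGeom

end

noncomputable section

/-! ### Schur's lemma over a commutative algebra with commuting derivations -/

namespace ParaGeom

namespace FormalMetric

open Matrix

variable {ι A : Type*} [Fintype ι] [CommRing A] [Algebra ℝ A]

/-! In para-holomorphic coordinates `G` splits into an unbarred block `g_{ab}` and a barred block.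
The correction terms `Φ`, `Ψ` in the characteristic connection have two effects: `L^{c̄}_{ab} =
L^{c̄}_{āb} = 0`, and `L^c_{ab}` is the Christoffel expression of `g_{ab}` with respect to `∂_1, …,
∂_m` alone (`charConn_inl_inl_inl` and its two companions). Hence every term of `Ric_{ca}` with a
barred index drops out, and `Ric_{ca}` is formally the Ricci tensor of an `m`-dimensional metric
(`charRic_inl_inl`).

The operators `∂_a` commute but are not real partial derivatives, so Schur's lemma cannot be quoted
from Riemannian geometry. Its proof is algebraic, however: metricity, skewness of the curvature and
the contracted second Bianchi identity hold over any commutative `ℝ`-algebra with commuting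
derivations. `FormalMetric.schur` gives `(m - 2) ∂_a f = 0` from `Ric_{ca} = f g_{ca}`. It is
applied to smooth functions on the chart target (`local_schur`). Although `C` has zero divisors, `m
- 2` is a nonzero real number and can be cancelled, so `∂_a f = 0`, which is `df ∘ I = -e df`.
Tracing the Einstein equation gives `ρ₀ = m f` in every chart, which yields the independence of
coordinates and the formula for `Ric`.

The passage from charts to `M` requires para-holomorphic coordinates around every point; they come
from first integrals of `T^±M` (`exists_paraHolomorphicChart`). -/

theorem map_mul_derivation (δ : Derivation ℝ A A) (P Q : Matrix ι ι A) :
    (P * Q).map δ = P.map δ * Q + P * Q.map δ := by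
  ext i j
  simp only [map_apply, mul_apply, Matrix.add_apply, map_sum, Derivation.leibniz, smul_eq_mul,
    ← Finset.sum_add_distrib]
  exact Finset.sum_congr rfl fun k _ ↦ by ring

/-- The matrices `(Γ_a)^c_b` of the Christoffel symbols of a symmetric matrix `g` with inverse `g'`
with respect to the derivations `d`. -/
def chris (d : ι → Derivation ℝ A A) (g g' : Matrix ι ι A) (a : ι) : Matrix ι ι A :=
  fun c b ↦ (1 / 2 : ℝ) • ∑ k, g' c k * (d a (g b k) + d b (g a k) - d k (g a b))

/-- The curvature matrices `(R_{ab})^d_c` of connection matrices `Γ`. -/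
def curv (d : ι → Derivation ℝ A A) (Γ : ι → Matrix ι ι A) (a b : ι) : Matrix ι ι A :=
  (Γ b).map (d a) - (Γ a).map (d b) + (Γ a * Γ b - Γ b * Γ a)

variable {d : ι → Derivation ℝ A A} {g g' : Matrix ι ι A}

theorem chris_symm (hg : gᵀ = g) (a b c : ι) : chris d g g' a c b = chris d g g' b c a := by
  have h : ∀ i j, g i j = g j i := fun i j ↦ congrFun₂ hg j i
  simp only [chris]
  congr 1
  refine Finset.sum_congr rfl fun k _ ↦ ?_
  rw [h a b]
  ring

variable [DecidableEq ι]

theorem mul_chris_apply (hinv : g * g' = 1) (a c b : ι) :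
    (g * chris d g g' a) c b = (1 / 2 : ℝ) • (d a (g b c) + d b (g a c) - d c (g a b)) := by
  have h : ∀ k, ∑ i, g c i * g' i k = (1 : Matrix ι ι A) c k := fun k ↦ by
    rw [← hinv, mul_apply]
  simp only [mul_apply, chris, mul_smul_comm, ← Finset.smul_sum]
  congr 1
  simp only [Finset.mul_sum, ← mul_assoc]
  rw [Finset.sum_comm]
  simp only [← Finset.sum_mul, h, one_apply, ite_mul, one_mul, zero_mul, Finset.sum_ite_eq,
    Finset.mem_univ, if_true]

/-- This is `∇g = 0`. Lowering the index of the Christoffel symbols and symmetrising cancels two of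
the three derivatives; the remaining one occurs twice, which absorbs the factor `1/2`. -/
theorem map_metric (hg : gᵀ = g) (hinv : g * g' = 1) (a : ι) :
    g.map (d a) = (chris d g g' a)ᵀ * g + g * chris d g g' a := by
  have h : ∀ i j, g i j = g j i := fun i j ↦ congrFun₂ hg j i
  have h2 : (chris d g g' a)ᵀ * g = (g * chris d g g' a)ᵀ := by rw [transpose_mul, hg]
  ext b c
  rw [h2, Matrix.add_apply, transpose_apply, mul_chris_apply hinv, mul_chris_apply hinv, map_apply,
    ← smul_add, h c b]
  have h3 : d a (g b c) + d b (g a c) - d c (g a b) +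
      (d a (g b c) + d c (g a b) - d b (g a c)) = (2 : ℝ) • d a (g b c) := by
    rw [two_smul]; ring
  rw [h3, smul_smul]
  norm_num

/-- Expanding `∂_b ∂_a g` by metricity twice and using that the derivations commute leaves exactly
the action of the curvature on `g`, which must therefore vanish. Symmetry of `Γ` plays no role. -/
theorem curv_skew {Γ : ι → Matrix ι ι A} (hd : ∀ a b x, d a (d b x) = d b (d a x))
    (hm : ∀ a, g.map (d a) = (Γ a)ᵀ * g + g * Γ a) (a b : ι) :
    (curv d Γ a b)ᵀ * g + g * curv d Γ a b = 0 := by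
  have ht : ∀ a b, ((Γ a)ᵀ).map (d b) = ((Γ a).map (d b))ᵀ := fun _ _ ↦ rfl
  have h2 : ∀ a b, (g.map (d a)).map (d b) =
      ((Γ a).map (d b))ᵀ * g + (Γ a)ᵀ * ((Γ b)ᵀ * g + g * Γ b) +
        (((Γ b)ᵀ * g + g * Γ b) * Γ a + g * (Γ a).map (d b)) := by
    intro a b
    rw [hm a, Matrix.map_add _ (fun x y ↦ map_add _ x y), map_mul_derivation,
      map_mul_derivation, hm b, ht]
  have h3 : (g.map (d a)).map (d b) = (g.map (d b)).map (d a) := by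
    ext i j
    exact hd b a _
  rw [h2, h2] at h3
  simp only [curv, transpose_add, transpose_sub, transpose_mul]
  have h4 := sub_eq_zero.2 h3.symm
  rw [← h4]
  noncomm_ring

/-- Differentiating `g g' = 1` shows that the inverse metric is parallel too, so raising an index
commutes with covariant differentiation. -/
theorem map_inv {Γ : ι → Matrix ι ι A} (hinv : g * g' = 1)
    (hm : ∀ a, g.map (d a) = (Γ a)ᵀ * g + g * Γ a) (a : ι) :
    g'.map (d a) = -(g' * (Γ a)ᵀ) - Γ a * g' := by
  have hinv' : g' * g = 1 := mul_eq_one_comm.1 hinv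
  have h := map_mul_derivation (d a) g g'
  have h1 : (1 : Matrix ι ι A).map (d a) = 0 := by
    ext i j
    by_cases hij : i = j <;> simp [one_apply, hij]
  rw [hinv, h1, hm a] at h
  have h5 : g' * (((Γ a)ᵀ * g + g * Γ a) * g' + g * g'.map (d a)) =
      g' * (Γ a)ᵀ * (g * g') + (g' * g) * Γ a * g' + (g' * g) * g'.map (d a) := by
    noncomm_ring
  rw [← h, hinv, hinv'] at h5
  simp only [mul_zero, one_mul, mul_one] at h5
  rw [eq_neg_of_add_eq_zero_right h5.symm]
  abel

/-- The second Bianchi identity for the curvature with its first two indices raised. -/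
theorem bianchi {Γ : ι → Matrix ι ι A} (hd : ∀ a b x, d a (d b x) = d b (d a x))
    (hinv : g * g' = 1) (hm : ∀ a, g.map (d a) = (Γ a)ᵀ * g + g * Γ a)
    (T : ι → ι → Matrix ι ι A) (hT : ∀ a b, T a b = curv d Γ a b * g') (p a b : ι) :
    ((T a b).map (d p) + Γ p * T a b + T a b * (Γ p)ᵀ) +
      ((T b p).map (d a) + Γ a * T b p + T b p * (Γ a)ᵀ) +
      ((T p a).map (d b) + Γ b * T p a + T p a * (Γ b)ᵀ) = 0 := by
  -- As `g'` is parallel, the raised index can be stripped off, leaving the covariant derivative of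
  -- the endomorphism-valued form `R_{ab}`. Only matrix indices are differentiated covariantly; this
  -- is the exterior form of the identity, valid without torsion-freeness.
  have h1 : ∀ p a b, (T a b).map (d p) + Γ p * T a b + T a b * (Γ p)ᵀ =
      ((curv d Γ a b).map (d p) + Γ p * curv d Γ a b - curv d Γ a b * Γ p) * g' := by
    intro p a b
    rw [hT, map_mul_derivation, map_inv hinv hm]
    noncomm_ring
  have h2 : ∀ a b p, (curv d Γ a b).map (d p) = ((Γ b).map (d a)).map (d p) -
      ((Γ a).map (d b)).map (d p) + ((Γ a).map (d p) * Γ b + Γ a * (Γ b).map (d p) -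
        ((Γ b).map (d p) * Γ a + Γ b * (Γ a).map (d p))) := by
    intro a b p
    simp only [curv]
    rw [Matrix.map_add _ (fun x y ↦ map_add _ x y), Matrix.map_sub _ (fun x y ↦ map_sub _ x y),
      Matrix.map_sub _ (fun x y ↦ map_sub _ x y), map_mul_derivation, map_mul_derivation]
  have h3 : ∀ a b c, ((Γ c).map (d a)).map (d b) = ((Γ c).map (d b)).map (d a) := by
    intro a b c
    ext i j
    exact hd b a _
  rw [h1, h1, h1, ← add_mul, ← add_mul, h2, h2, h2, h3 a p b, h3 b p a, h3 b a p]
  simp only [curv]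
  convert zero_mul g' using 2
  noncomm_ring

/-- Schur's lemma: if the Ricci tensor is `f g`, then `(n - 2) df = 0`. -/
theorem schur (hd : ∀ a b x, d a (d b x) = d b (d a x)) (hg : gᵀ = g) (hinv : g * g' = 1) (f : A)
    (hric : ∀ c a, ∑ b, curv d (chris d g g') a b b c = f * g c a) (p : ι) :
    ((Fintype.card ι : A) - 2) * d p f = 0 := by
  set Γ := chris d g g' with hΓ
  have hΓs : ∀ a b c, Γ a c b = Γ b c a := chris_symm hg
  have hm : ∀ a, g.map (d a) = (Γ a)ᵀ * g + g * Γ a := map_metric hg hinv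
  have hinv' : g' * g = 1 := mul_eq_one_comm.1 hinv
  have hg' : g'ᵀ = g' := by
    have h : g'ᵀ * g = 1 := by rw [← hg, ← transpose_mul, hinv, transpose_one]
    calc g'ᵀ = g'ᵀ * (g * g') := by rw [hinv, mul_one]
      _ = g' := by rw [← mul_assoc, h, one_mul]
  -- `T a b i j` is `R_{ab}` with upper indices `i j`. With both indices raised, the Einstein
  -- condition makes every single contraction equal to `±f` times a Kronecker delta, so traces can
  -- be taken before differentiating.
  obtain ⟨T, hT⟩ : ∃ T : ι → ι → Matrix ι ι A, ∀ a b, T a b = curv d Γ a b * g' :=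
    ⟨_, fun _ _ ↦ rfl⟩
  have hTs : ∀ a b i j, T a b i j = -T a b j i := by
    intro a b
    have h := curv_skew hd hm a b
    have h2 : T a b + (T a b)ᵀ = g' * ((curv d Γ a b)ᵀ * g + g * curv d Γ a b) * g' := by
      rw [hT, transpose_mul, hg']
      have : g' * ((curv d Γ a b)ᵀ * g + g * curv d Γ a b) * g' =
        g' * (curv d Γ a b)ᵀ * (g * g') + (g' * g) * curv d Γ a b * g' := by noncomm_ring
      rw [this, hinv, hinv', mul_one, one_mul, add_comm]
    rw [h, mul_zero, zero_mul] at h2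
    intro i j
    exact eq_neg_of_add_eq_zero_left (congrFun₂ h2 i j)
  have hTa : ∀ a b i j, T a b i j = -T b a i j := by
    intro a b i j
    have : T a b = -T b a := by
      rw [hT, hT, curv, curv]; noncomm_ring
    rw [this, neg_apply]
  have hTc : ∀ a c, ∑ b, T a b b c = if c = a then f else 0 := by
    intro a c
    simp only [hT, mul_apply]
    rw [Finset.sum_comm]
    simp only [← Finset.sum_mul, hric]
    have : ∀ k, f * g k a * g' k c = f * (g' c k * g k a) := fun k ↦ by
      rw [← congrFun₂ hg' k c, transpose_apply]; ring
    simp only [this, ← Finset.mul_sum, ← mul_apply, hinv', one_apply, mul_ite, mul_one, mul_zero]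
  have hTc1 : ∀ a c, ∑ b, T b a b c = if c = a then -f else 0 := by
    intro a c
    rw [Finset.sum_congr rfl fun b _ ↦ hTa b a b c, Finset.sum_neg_distrib, hTc]
    split_ifs <;> simp
  have hTc2 : ∀ a c, ∑ b, T a b c b = if c = a then -f else 0 := by
    intro a c
    rw [Finset.sum_congr rfl fun b _ ↦ hTs a b c b, Finset.sum_neg_distrib, hTc]
    split_ifs <;> simp
  have hTc3 : ∀ a c, ∑ b, T b a c b = if c = a then f else 0 := by
    intro a c
    rw [Finset.sum_congr rfl fun b _ ↦ hTs b a c b, Finset.sum_neg_distrib, hTc1]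
    split_ifs <;> simp
  -- contractions of a symmetric with a skew-symmetric matrix vanish
  have hskew : ∀ (S W : ι → ι → A), (∀ i j, S i j = S j i) → (∀ i j, W i j = -W j i) →
      ∑ i, ∑ j, S i j * W i j = 0 := by
    intro S W hS hW
    have h : ∑ i, ∑ j, S i j * W i j = -∑ i, ∑ j, S i j * W i j := by
      nth_rewrite 1 [Finset.sum_comm]
      simp only [← Finset.sum_neg_distrib]
      refine Finset.sum_congr rfl fun i _ ↦ Finset.sum_congr rfl fun j _ ↦ ?_
      rw [hS j i, hW j i]; ring
    have h2 : (2 : ℝ) • ∑ i, ∑ j, S i j * W i j = 0 := by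
      rw [two_smul]; nth_rewrite 1 [h]; exact neg_add_cancel _
    have h3 := congrArg ((1 / 2 : ℝ) • ·) h2
    simpa [smul_smul] using h3
  have hb := bianchi hd hinv hm T hT p
  -- Full contraction of Bianchi: `b` with the first upper index, `a` with the second. Each cyclic
  -- term yields one derivative term and two `Γ` terms, evaluated in `e1`–`e9`. The derivatives give
  -- `(n - 1 - 1) ∂_p f`. The `Γ` terms give `2 f t - 2 f t`, with `t` the trace of `Γ p`, and two
  -- contractions of a symmetric with a skew matrix.
  have hb2 : ∑ a, ∑ b, (((T a b).map (d p) + Γ p * T a b + T a b * (Γ p)ᵀ) +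
      ((T b p).map (d a) + Γ a * T b p + T b p * (Γ a)ᵀ) +
      ((T p a).map (d b) + Γ b * T p a + T p a * (Γ b)ᵀ)) b a = 0 :=
    Finset.sum_eq_zero fun a _ ↦ Finset.sum_eq_zero fun b _ ↦ by rw [hb]; rfl
  simp only [Matrix.add_apply, map_apply, mul_apply, transpose_apply, Finset.sum_add_distrib] at hb2
  set t := ∑ i, Γ p i i with ht
  have e1 : ∑ a, ∑ b, d p (T a b b a) = Fintype.card ι * d p f := by
    simp only [← map_sum, hTc]
    simp
  have e2 : ∑ a, ∑ b, ∑ k, Γ p b k * T a b k a = f * t := by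
    rw [Finset.sum_comm, ht, Finset.mul_sum]
    refine Finset.sum_congr rfl fun b _ ↦ ?_
    rw [Finset.sum_comm]
    simp only [← Finset.mul_sum, hTc3]
    simp [mul_comm]
  have e3 : ∑ a, ∑ b, ∑ k, T a b b k * Γ p a k = f * t := by
    rw [ht, Finset.mul_sum]
    refine Finset.sum_congr rfl fun a _ ↦ ?_
    rw [Finset.sum_comm]
    simp [← Finset.sum_mul, hTc]
  have e4 : ∑ a, ∑ b, d a (T b p b a) = -d p f := by
    simp only [← map_sum, hTc1]
    rw [Finset.sum_eq_single p (fun a _ ha ↦ by simp [ha]) (by simp)]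
    simp
  have e5 : ∑ a, ∑ b, ∑ k, Γ a b k * T b p k a = 0 := by
    rw [Finset.sum_comm]
    refine Finset.sum_eq_zero fun b _ ↦ ?_
    exact hskew (fun a k ↦ Γ a b k) (fun a k ↦ T b p k a) (fun i j ↦ hΓs _ _ _)
      (fun i j ↦ hTs _ _ _ _)
  have e6 : ∑ a, ∑ b, ∑ k, T b p b k * Γ a a k = -(f * t) := by
    rw [ht, Finset.mul_sum, ← Finset.sum_neg_distrib]
    refine Finset.sum_congr rfl fun a _ ↦ ?_
    rw [Finset.sum_comm]
    simp [← Finset.sum_mul, hTc1, hΓs a p a]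
  have e7 : ∑ a, ∑ b, d b (T p a b a) = -d p f := by
    rw [Finset.sum_comm]
    simp only [← map_sum, hTc2]
    rw [Finset.sum_eq_single p (fun a _ ha ↦ by simp [ha]) (by simp)]
    simp
  have e8 : ∑ a, ∑ b, ∑ k, Γ b b k * T p a k a = -(f * t) := by
    rw [Finset.sum_comm, ht, Finset.mul_sum, ← Finset.sum_neg_distrib]
    refine Finset.sum_congr rfl fun b _ ↦ ?_
    rw [Finset.sum_comm]
    simp only [← Finset.mul_sum, hTc2]
    simp [hΓs b p b, mul_comm]
  have e9 : ∑ a, ∑ b, ∑ k, T p a b k * Γ b a k = 0 := by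
    refine Finset.sum_eq_zero fun a _ ↦ ?_
    rw [← hskew (fun b k ↦ Γ b a k) (fun b k ↦ T p a b k) (fun i j ↦ hΓs _ _ _)
      (fun i j ↦ hTs _ _ _ _)]
    exact Finset.sum_congr rfl fun _ _ ↦ Finset.sum_congr rfl fun _ _ ↦ mul_comm _ _
  rw [e1, e2, e3, e4, e5, e6, e7, e8, e9] at hb2
  linear_combination hb2

end FormalMetric

end ParaGeom

end
noncomputable section

namespace ParaGeom

open ParaComplex TopologicalSpace

/-! ### Calculus of para-complex valued functions -/

/-- Multiplication of para-complex numbers as a continuous bilinear map. -/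
def mulL : ParaComplex →L[ℝ] ParaComplex →L[ℝ] ParaComplex :=
  LinearMap.toContinuousLinearMap
    ((LinearMap.toContinuousLinearMap : (ParaComplex →ₗ[ℝ] ParaComplex) ≃ₗ[ℝ] _).toLinearMap ∘ₗ
      LinearMap.mul ℝ ParaComplex)

@[simp]
theorem mulL_apply (z w : ParaComplex) : mulL z w = z * w := rfl

section Calculus

variable {E : Type*} [NormedAddCommGroup E] [NormedSpace ℝ E] {f g : E → ParaComplex} {x : E}
  {s : Set E} {n : WithTop ℕ∞}

theorem contDiffOn_mul (hf : ContDiffOn ℝ n f s) (hg : ContDiffOn ℝ n g s) :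
    ContDiffOn ℝ n (fun x ↦ f x * g x) s :=
  (mulL.contDiff.comp_contDiffOn hf).clm_apply hg

theorem fderiv_mul_apply (hf : DifferentiableAt ℝ f x) (hg : DifferentiableAt ℝ g x) (v : E) :
    fderiv ℝ (fun x ↦ f x * g x) x v = f x * fderiv ℝ g x v + fderiv ℝ f x v * g x := by
  have h := mulL.fderiv_of_bilinear hf hg
  have h2 := congrArg (fun L : E →L[ℝ] ParaComplex ↦ L v) h
  simpa [ContinuousLinearMap.precompR, ContinuousLinearMap.precompL] using h2

theorem contDiffOn_re (hf : ContDiffOn ℝ n f s) : ContDiffOn ℝ n (fun x ↦ (f x).re) s :=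
  (LinearMap.toContinuousLinearMap (QuadraticAlgebra.reₗ (1 : ℝ) 0)).contDiff.comp_contDiffOn hf

theorem contDiffOn_im (hf : ContDiffOn ℝ n f s) : ContDiffOn ℝ n (fun x ↦ (f x).im) s :=
  (LinearMap.toContinuousLinearMap (QuadraticAlgebra.imₗ (1 : ℝ) 0)).contDiff.comp_contDiffOn hf

theorem mul_inv_smul_star {z : ParaComplex} (h : z.re ^ 2 - z.im ^ 2 ≠ 0) :
    z * ((z.re ^ 2 - z.im ^ 2)⁻¹ • star z) = 1 := by
  have h1 : z * star z = (z.re ^ 2 - z.im ^ 2) • (1 : ParaComplex) := by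
    ext <;> simp [QuadraticAlgebra.re_one, QuadraticAlgebra.im_one] <;> ring
  rw [mul_smul_comm, h1, smul_smul, inv_mul_cancel₀ h, one_smul]

/-- `C` is not a field: the norm `z * star z = x² - y²` vanishes on the null lines `y = ± x`, and it
is multiplicative, so it detects units. -/
theorem isUnit_iff (z : ParaComplex) : IsUnit z ↔ z.re ^ 2 - z.im ^ 2 ≠ 0 := by
  constructor
  · rintro h h0
    obtain ⟨w, hw⟩ := h.exists_right_inv
    have h1 := congrArg QuadraticAlgebra.re hw
    have h2 := congrArg QuadraticAlgebra.im hw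
    simp [QuadraticAlgebra.re_one, QuadraticAlgebra.im_one] at h1 h2
    have : (z.re ^ 2 - z.im ^ 2) * (w.re ^ 2 - w.im ^ 2) = 1 := by
      linear_combination (z.re * w.re + z.im * w.im + 1) * h1 -
        (z.re * w.im + z.im * w.re) * h2
    simp [h0] at this
  · intro h
    exact IsUnit.of_mul_eq_one _ (mul_inv_smul_star h)

theorem exists_contDiffOn_inv (hf : ContDiffOn ℝ n f s) (hu : ∀ x ∈ s, IsUnit (f x)) :
    ∃ g : E → ParaComplex, ContDiffOn ℝ n g s ∧ ∀ x ∈ s, f x * g x = 1 := by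
  refine ⟨fun x ↦ ((f x).re ^ 2 - (f x).im ^ 2)⁻¹ • star (f x), ?_, fun x hx ↦ ?_⟩
  · refine ContDiffOn.smul (ContDiffOn.inv ?_ fun x hx ↦ (isUnit_iff _).1 (hu x hx)) ?_
    · exact ((contDiffOn_re hf).pow 2).sub ((contDiffOn_im hf).pow 2)
    · exact (LinearMap.toContinuousLinearMap conjₗ).contDiff.comp_contDiffOn hf
  · have := (isUnit_iff _).1 (hu x hx)
    exact mul_inv_smul_star this

end Calculus

variable {m : ℕ}

/-- The number `± e` in the definition of `∂/∂z^A`. -/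
def sgnE : Idx m → ParaComplex := Sum.elim (fun _ ↦ e) (fun _ ↦ -e)

/-! ### Leibniz rule, smoothness and commutation for the operators `∂_A`. -/

theorem pd_eq (h : Model m → ParaComplex) (A : Idx m) (x : Model m) :
    pd h A x = (1 / 2 : ℝ) • (fderiv ℝ h x (dirX (A.elim id id)) +
      sgnE A * fderiv ℝ h x (dirY (A.elim id id))) := by
  cases A <;> simp [pd, sgnE, sub_eq_add_neg]

/-- Lets functions known only on an open set be differentiated through an arbitrary extension; the
derivations of `smoothFun` are well behaved for this reason. -/
theorem pd_congr {h k : Model m → ParaComplex} {s : Set (Model m)} (hs : IsOpen s)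
    (hk : ∀ x ∈ s, h x = k x) (A : Idx m) {x : Model m} (hx : x ∈ s) : pd h A x = pd k A x := by
  have : h =ᶠ[nhds x] k := Filter.eventuallyEq_of_mem (hs.mem_nhds hx) hk
  rw [pd_eq, pd_eq, this.fderiv_eq]

theorem pd_zero (A : Idx m) (x : Model m) : pd (fun _ ↦ 0) A x = 0 := by
  simp [pd_eq]

theorem pd_add {h k : Model m → ParaComplex} {x : Model m} (hh : DifferentiableAt ℝ h x)
    (hk : DifferentiableAt ℝ k x) (A : Idx m) :
    pd (fun y ↦ h y + k y) A x = pd h A x + pd k A x := by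
  rw [pd_eq, pd_eq, pd_eq, fderiv_fun_add hh hk, ← smul_add]
  congr 1
  simp only [add_apply]
  ring

theorem pd_mul {h k : Model m → ParaComplex} {x : Model m} (hh : DifferentiableAt ℝ h x)
    (hk : DifferentiableAt ℝ k x) (A : Idx m) :
    pd (fun y ↦ h y * k y) A x = h x * pd k A x + k x * pd h A x := by
  rw [pd_eq, pd_eq, pd_eq, fderiv_mul_apply hh hk, fderiv_mul_apply hh hk, mul_smul_comm,
    mul_smul_comm, ← smul_add]
  congr 1
  ring

theorem pd_const_mul (c : ParaComplex) {h : Model m → ParaComplex} {x : Model m}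
    (hh : DifferentiableAt ℝ h x) (A : Idx m) : pd (fun y ↦ c * h y) A x = c * pd h A x := by
  rw [pd_mul (differentiableAt_const c) hh]
  simp [pd_eq]

theorem contDiffOn_fderiv_apply {h : Model m → ParaComplex} {s : Set (Model m)} (hs : IsOpen s)
    (hh : ContDiffOn ℝ ∞ h s) (v : Model m) : ContDiffOn ℝ ∞ (fun x ↦ fderiv ℝ h x v) s :=
  (hh.fderiv_of_isOpen (m := ∞) hs (by simp)).clm_apply contDiffOn_const

theorem contDiffOn_pd {h : Model m → ParaComplex} {s : Set (Model m)} (hs : IsOpen s)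
    (hh : ContDiffOn ℝ ∞ h s) (A : Idx m) : ContDiffOn ℝ ∞ (pd h A) s := by
  have : pd h A = fun x ↦ (1 / 2 : ℝ) • (fderiv ℝ h x (dirX (A.elim id id)) +
      sgnE A * fderiv ℝ h x (dirY (A.elim id id))) := funext (pd_eq h A)
  rw [this]
  exact ((contDiffOn_fderiv_apply hs hh _).add
    (contDiffOn_mul contDiffOn_const (contDiffOn_fderiv_apply hs hh _))).const_smul (1 / 2 : ℝ)

theorem fderiv_pd_apply {h : Model m → ParaComplex} {s : Set (Model m)} (hs : IsOpen s)
    (hh : ContDiffOn ℝ ∞ h s) (A : Idx m) {x : Model m} (hx : x ∈ s) (v : Model m) :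
    fderiv ℝ (pd h A) x v = (1 / 2 : ℝ) • (fderiv ℝ (fderiv ℝ h) x v (dirX (A.elim id id)) +
      sgnE A * fderiv ℝ (fderiv ℝ h) x v (dirY (A.elim id id))) := by
  have hd : DifferentiableAt ℝ (fderiv ℝ h) x :=
    ((hh.fderiv_of_isOpen (m := ∞) hs (by simp)).differentiableOn (by simp)).differentiableAt
      (hs.mem_nhds hx)
  have hd1 : ∀ w, HasFDerivAt (fun y ↦ fderiv ℝ h y w) ((fderiv ℝ (fderiv ℝ h) x).flip w) x :=
    fun w ↦ by simpa using hd.hasFDerivAt.clm_apply (hasFDerivAt_const w x)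
  have hp : pd h A = fun x ↦ (1 / 2 : ℝ) • (fderiv ℝ h x (dirX (A.elim id id)) +
      mulL (sgnE A) (fderiv ℝ h x (dirY (A.elim id id)))) := funext (pd_eq h A)
  have hf := ((hd1 (dirX (A.elim id id))).add ((mulL (sgnE A)).hasFDerivAt.comp x
    (hd1 (dirY (A.elim id id))))).const_smul (1 / 2 : ℝ)
  rw [hp]
  exact congrArg (fun L : Model m →L[ℝ] ParaComplex ↦ L v) hf.fderiv

theorem pd_comm {h : Model m → ParaComplex} {s : Set (Model m)} (hs : IsOpen s)
    (hh : ContDiffOn ℝ ∞ h s) (A B : Idx m) {x : Model m} (hx : x ∈ s) :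
    pd (pd h A) B x = pd (pd h B) A x := by
  have hsymm : ∀ v w, fderiv ℝ (fderiv ℝ h) x v w = fderiv ℝ (fderiv ℝ h) x w v :=
    ((hh.contDiffAt (hs.mem_nhds hx)).isSymmSndFDerivAt
      (by simpa using WithTop.coe_le_coe.2 (le_top : (2 : ℕ∞) ≤ ⊤))).eq
  rw [pd_eq, pd_eq]
  simp only [fderiv_pd_apply hs hh _ hx]
  rw [hsymm (dirX (B.elim id id)) (dirX (A.elim id id)),
    hsymm (dirX (B.elim id id)) (dirY (A.elim id id)),
    hsymm (dirY (B.elim id id)) (dirX (A.elim id id)),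
    hsymm (dirY (B.elim id id)) (dirY (A.elim id id))]
  congr 1
  simp only [mul_smul_comm, ← smul_add]
  congr 1
  ring

/-! ### The algebra of smooth functions on an open subset of the model space -/

open Classical in
/-- Extension by zero of a function on an open set. -/
def extZero (U : Opens (Model m)) (h : U → ParaComplex) (x : Model m) : ParaComplex :=
  if hx : x ∈ U then h ⟨x, hx⟩ else 0

theorem extZero_apply {U : Opens (Model m)} (h : U → ParaComplex) {x : Model m} (hx : x ∈ U) :
    extZero U h x = h ⟨x, hx⟩ := dif_pos hx

/-- The algebra of smooth para-complex valued functions on an open set. -/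
def smoothFun (U : Opens (Model m)) : Subalgebra ℝ (U → ParaComplex) where
  -- Elements live on the subtype `U`, so equality and invertibility only see the points of `U`; the
  -- extension by zero serves to express smoothness through `ContDiffOn`.
  carrier := {h | ContDiffOn ℝ ∞ (extZero U h) U}
  mul_mem' {h k} hh hk := (contDiffOn_mul hh hk).congr fun x hx ↦ by
    simp [extZero_apply _ hx]
  add_mem' {h k} hh hk := (ContDiffOn.add hh hk).congr fun x hx ↦ by
    simp [extZero_apply _ hx]
  algebraMap_mem' r := (contDiffOn_const (c := algebraMap ℝ ParaComplex r)).congr fun x hx ↦ by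
    simp [extZero_apply _ hx]

variable {U : Opens (Model m)}

/-- The restriction to `U` of a function that is smooth on `U`. -/
def smoothFun.mk (h : Model m → ParaComplex) (hh : ContDiffOn ℝ ∞ h U) : smoothFun U :=
  ⟨fun x ↦ h x, hh.congr fun x hx ↦ by simp [extZero_apply _ hx]⟩

theorem smoothFun.differentiableAt (h : smoothFun U) {x : Model m} (hx : x ∈ U) :
    DifferentiableAt ℝ (extZero U h) x :=
  ((show ContDiffOn ℝ ∞ _ _ from h.2).differentiableOn (by simp)).differentiableAt
    (U.isOpen.mem_nhds hx)

/-- The derivation `∂/∂z^A` of the algebra of smooth functions. -/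
def smoothFun.pd (A : Idx m) : Derivation ℝ (smoothFun U) (smoothFun U) :=
  Derivation.mk'
    { toFun := fun h ↦ smoothFun.mk (ParaGeom.pd (extZero U h) A) (contDiffOn_pd U.isOpen h.2 A)
      map_add' := fun h k ↦ by
        ext1; funext x
        change ParaGeom.pd (extZero U _) A x = ParaGeom.pd _ A x + ParaGeom.pd _ A x
        rw [← pd_add (smoothFun.differentiableAt h x.2) (smoothFun.differentiableAt k x.2)]
        exact pd_congr U.isOpen (fun y hy ↦ by simp [extZero_apply _ hy]) A x.2
      map_smul' := fun r h ↦ by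
        ext1; funext x
        change ParaGeom.pd (extZero U _) A x = r • ParaGeom.pd _ A x
        rw [← algebraMap_smul ParaComplex r (ParaGeom.pd _ A x), smul_eq_mul,
          ← pd_const_mul _ (smoothFun.differentiableAt h x.2)]
        exact pd_congr U.isOpen (fun y hy ↦ by
          simp [extZero_apply _ hy, ← smul_eq_mul]) A x.2 }
    fun h k ↦ by
      ext1; funext x
      change ParaGeom.pd (extZero U _) A x =
        h.1 x * ParaGeom.pd _ A x + k.1 x * ParaGeom.pd _ A x
      rw [← extZero_apply h.1 x.2, ← extZero_apply k.1 x.2,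
        ← pd_mul (smoothFun.differentiableAt h x.2) (smoothFun.differentiableAt k x.2)]
      exact pd_congr U.isOpen (fun y hy ↦ by simp [extZero_apply _ hy]) A x.2

theorem smoothFun.pd_apply (A : Idx m) {h : smoothFun U} {k : Model m → ParaComplex}
    (hk : ∀ x : U, h.1 x = k x) (x : U) : (smoothFun.pd A h).1 x = ParaGeom.pd k A x :=
  pd_congr U.isOpen (fun y hy ↦ by rw [extZero_apply _ hy]; exact hk ⟨y, hy⟩) A x.2

theorem smoothFun.pd_comm (A B : Idx m) (h : smoothFun U) :
    smoothFun.pd A (smoothFun.pd B h) = smoothFun.pd B (smoothFun.pd A h) := by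
  ext1; funext x
  rw [smoothFun.pd_apply A (k := ParaGeom.pd (extZero U h) B) (fun _ ↦ rfl),
    smoothFun.pd_apply B (k := ParaGeom.pd (extZero U h) A) (fun _ ↦ rfl)]
  exact ParaGeom.pd_comm U.isOpen h.2 B A x.2

/-- Evaluation at a point. -/
def smoothFun.eval (x : U) : smoothFun U →ₐ[ℝ] ParaComplex :=
  (Pi.evalAlgHom ℝ (fun _ : U ↦ ParaComplex) x).comp (smoothFun U).val

theorem smoothFun.eval_apply (x : U) (h : smoothFun U) : smoothFun.eval x h = h.1 x := rfl

/-- A matrix of smooth functions with pointwise invertible determinant has a smooth inverse. -/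
theorem smoothFun.exists_mul_eq_one {ι : Type*} [Fintype ι] [DecidableEq ι]
    (g : Matrix ι ι (smoothFun U)) (hg : ∀ x : U, IsUnit (g.map (smoothFun.eval x)).det) :
    ∃ g' : Matrix ι ι (smoothFun U), g * g' = 1 := by
  have hu : ∀ x ∈ U, IsUnit (extZero U g.det x) := fun x hx ↦ by
    rw [extZero_apply _ hx, ← smoothFun.eval_apply]
    have := hg ⟨x, hx⟩
    rwa [← AlgHom.mapMatrix_apply, ← AlgHom.map_det] at this
  obtain ⟨k, hk, hk1⟩ := exists_contDiffOn_inv g.det.2 hu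
  have hdet : IsUnit g.det := by
    refine IsUnit.of_mul_eq_one (smoothFun.mk k hk) ?_
    ext1; funext x
    have := hk1 x x.2
    rwa [extZero_apply _ x.2] at this
  exact ⟨g⁻¹, Matrix.mul_nonsing_inv g hdet⟩

end ParaGeom

end
noncomputable section

namespace ParaGeom

open ParaComplex TopologicalSpace

variable {m : ℕ} {M : Type*} [TopologicalSpace M] [ChartedSpace (Model m) M]

/-! ### Coordinate vectors -/

section Charts

variable {φ : OpenPartialHomeomorph M (Model m)}

theorem mdifferentiable_of_mem_smoothCharts (hφ : φ ∈ smoothCharts m M) :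
    φ.MDifferentiable 𝓘(ℝ, Model m) 𝓘(ℝ, Model m) :=
  ⟨(contMDiffOn_of_mem_maximalAtlas hφ).mdifferentiableOn (by simp),
    (contMDiffOn_symm_of_mem_maximalAtlas hφ).mdifferentiableOn (by simp)⟩

theorem coordVec_bijective (hφ : φ ∈ smoothCharts m M) {x : Model m} (hx : x ∈ φ.target) :
    Function.Bijective (coordVec φ x) :=
  (mdifferentiable_of_mem_smoothCharts hφ).symm.mfderiv_bijective hx

end Charts

/-- `coordVec` as a linear map. -/
def coordVecₗ (φ : OpenPartialHomeomorph M (Model m)) (x : Model m) :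
    Model m →ₗ[ℝ] RealTangent m (φ.symm x) :=
  (mfderiv 𝓘(ℝ, Model m) 𝓘(ℝ, Model m) φ.symm x : _ →L[ℝ] _).toLinearMap

theorem coordVecₗ_apply (φ : OpenPartialHomeomorph M (Model m)) (x v : Model m) :
    coordVecₗ φ x v = coordVec φ x v := rfl

/-- The para-complex number `1/2`. -/
def half : ParaComplex := algebraMap ℝ ParaComplex (1 / 2)

theorem half_add_half : half + half = 1 := by
  rw [half, ← map_add]
  norm_num

theorem half_smul (z : ParaComplex) : (1 / 2 : ℝ) • z = half * z := by
  rw [half, Algebra.smul_def]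

theorem sgnE_mul_self (A : Idx m) : sgnE A * sgnE A = 1 := by
  cases A <;> simp [sgnE, e_mul_e]

section Tensor

variable {V : Type*} [AddCommGroup V] [Module ℝ V]

theorem neg_smul_tensor (z : ParaComplex) (Z : ParaComplex ⊗[ℝ] V) : (-z) • Z = -(z • Z) :=
  neg_smul z Z

theorem neg_tmul_tensor (z : ParaComplex) (v : V) : (-z) ⊗ₜ[ℝ] v = -(z ⊗ₜ[ℝ] v) :=
  TensorProduct.neg_tmul z v

theorem half_smul_add_add (Z W : ParaComplex ⊗[ℝ] V) :
    half • (Z + e • W) + half • (Z + (-e) • W) = Z := by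
  calc half • (Z + e • W) + half • (Z + (-e) • W) = (half + half) • Z := by module
    _ = Z := by rw [half_add_half, one_smul]

theorem e_smul_half_smul_sub (Z W : ParaComplex ⊗[ℝ] V) :
    e • (half • (Z + e • W) - half • (Z + (-e) • W)) = W := by
  calc e • (half • (Z + e • W) - half • (Z + (-e) • W)) = ((half + half) * (e * e)) • W := by module
    _ = W := by rw [half_add_half, e_mul_e, one_mul, one_smul]

end Tensor

theorem coordC_eq (φ : OpenPartialHomeomorph M (Model m)) (x : Model m) (A : Idx m) :
    coordC φ x A = half • ((1 : ParaComplex) ⊗ₜ[ℝ] coordVec φ x (dirX (A.elim id id)) +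
      sgnE A • (1 : ParaComplex) ⊗ₜ[ℝ] coordVec φ x (dirY (A.elim id id))) := by
  rw [half, algebraMap_smul]
  cases A
  · simp [coordC, sgnE, TensorProduct.smul_tmul']
  · simp only [coordC, sgnE, Sum.elim_inr, id, TensorProduct.smul_tmul', sub_eq_add_neg,
      smul_eq_mul, mul_one]
    rw [neg_tmul_tensor]

theorem e_smul_dirX (a : Fin m) : e • dirX a = dirY a := by
  ext b <;> by_cases h : b = a <;> simp [dirX, dirY, h]

theorem e_smul_dirY (a : Fin m) : e • dirY a = dirX a := by
  rw [← e_smul_dirX, smul_smul, e_mul_e, one_smul]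

theorem model_eq_sum (v : Model m) :
    v = ∑ a, ((v a).re • dirX a + (v a).im • dirY a) := by
  funext b
  rw [Finset.sum_apply, Finset.sum_eq_single b]
  · ext <;> simp [dirX, dirY, e, QuadraticAlgebra.re_one, QuadraticAlgebra.im_one]
  · intro a _ ha
    simp [dirX, dirY, ha.symm]
  · simp

theorem coordC_inl_add_inr (φ : OpenPartialHomeomorph M (Model m)) (x : Model m) (a : Fin m) :
    coordC φ x (Sum.inl a) + coordC φ x (Sum.inr a) =
      (1 : ParaComplex) ⊗ₜ[ℝ] coordVec φ x (dirX a) := by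
  rw [coordC_eq, coordC_eq]
  exact half_smul_add_add _ _

theorem e_smul_coordC_inl_sub_inr (φ : OpenPartialHomeomorph M (Model m)) (x : Model m) (a : Fin m) :
    e • (coordC φ x (Sum.inl a) - coordC φ x (Sum.inr a)) =
      (1 : ParaComplex) ⊗ₜ[ℝ] coordVec φ x (dirY a) := by
  rw [coordC_eq, coordC_eq]
  exact e_smul_half_smul_sub _ _

section Basis

variable {φ : OpenPartialHomeomorph M (Model m)}

theorem span_coordC (hφ : φ ∈ smoothCharts m M) {x : Model m} (hx : x ∈ φ.target) :
    Submodule.span ParaComplex (Set.range (coordC φ x)) = ⊤ := by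
  rw [eq_top_iff]
  rintro Z -
  have hc : ∀ A, coordC φ x A ∈ Submodule.span ParaComplex (Set.range (coordC φ x)) :=
    fun A ↦ Submodule.subset_span ⟨A, rfl⟩
  induction Z using TensorProduct.induction_on with
  | zero => exact zero_mem _
  | add Z W hZ hW => exact add_mem hZ hW
  | tmul z w =>
    have hw : (1 : ParaComplex) ⊗ₜ[ℝ] w ∈ Submodule.span ParaComplex (Set.range (coordC φ x)) := by
      obtain ⟨v, rfl⟩ := (coordVec_bijective hφ hx).2 w
      rw [← coordVecₗ_apply, model_eq_sum v, map_sum, TensorProduct.tmul_sum]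
      refine sum_mem fun a _ ↦ ?_
      rw [map_add, map_smul, map_smul, TensorProduct.tmul_add, TensorProduct.tmul_smul,
        TensorProduct.tmul_smul, coordVecₗ_apply, coordVecₗ_apply, ← coordC_inl_add_inr,
        ← e_smul_coordC_inl_sub_inr]
      exact add_mem (Submodule.smul_of_tower_mem _ _ (add_mem (hc _) (hc _)))
        (Submodule.smul_of_tower_mem _ _ (Submodule.smul_mem _ _ (sub_mem (hc _) (hc _))))
    have : z ⊗ₜ[ℝ] w = z • ((1 : ParaComplex) ⊗ₜ[ℝ] w) := by
      rw [TensorProduct.smul_tmul', smul_eq_mul, mul_one]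
    rw [this]
    exact Submodule.smul_mem _ _ hw

theorem finrank_paraComplex : Module.finrank ℝ ParaComplex = 2 :=
  QuadraticAlgebra.finrank_eq_two _ _

/-- The `2m` vectors span, and both modules have real dimension `4m`, so the surjection from
coefficients is injective. The count is made over `ℝ` because `C` is not a field. -/
theorem coordC_sum_injective (hφ : φ ∈ smoothCharts m M) {x : Model m} (hx : x ∈ φ.target)
    {v : Idx m → ParaComplex} (hv : ∑ A, v A • coordC φ x A = 0) : v = 0 := by
  let Ξ : (Idx m → ParaComplex) →ₗ[ParaComplex] CTangent m (φ.symm x) :=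
    Fintype.linearCombination ParaComplex (coordC φ x)
  have hs : Function.Surjective Ξ := by
    rw [← LinearMap.range_eq_top, Fintype.range_linearCombination]
    exact span_coordC hφ hx
  have hf : FiniteDimensional ℝ (RealTangent m (φ.symm x)) :=
    inferInstanceAs (FiniteDimensional ℝ (Model m))
  have h1 : Module.finrank ℝ (RealTangent m (φ.symm x)) = Module.finrank ℝ (Model m) := rfl
  have hr : Module.finrank ℝ (Idx m → ParaComplex) =
      Module.finrank ℝ (CTangent m (φ.symm x)) := by
    rw [Module.finrank_tensorProduct, h1, Module.finrank_pi_fintype, Module.finrank_pi_fintype]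
    simp [finrank_paraComplex]
    ring
  have hi := (LinearMap.injective_iff_surjective_of_finrank_eq_finrank
    (f := Ξ.restrictScalars ℝ) hr).2 hs
  exact hi (by rw [map_zero]; exact hv)

end Basis

/-! ### The components of the metric in para-holomorphic coordinates -/

section Metric

variable [IsManifold 𝓘(ℝ, Model m) ∞ M] {J : ParaComplexStructure m M}
  (G : ParaComplexRiemannianMetric J) {φ : OpenPartialHomeomorph M (Model m)}

theorem localG_symm (x : Model m) (A B : Idx m) : localG G φ x A B = localG G φ x B A :=
  G.symm _ _ _

theorem contDiffOn_localG (hφ : φ ∈ smoothCharts m M) (A B : Idx m) :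
    ContDiffOn ℝ ∞ (fun x ↦ localG G φ x A B) φ.target := by
  have h := fun v w ↦ G.smooth φ hφ v w
  simp only [localG, coordC_eq, map_smul, map_add, LinearMap.smul_apply, LinearMap.add_apply,
    smul_eq_mul]
  have hc : ∀ c : ParaComplex, ContDiffOn ℝ ∞ (fun _ : Model m ↦ c) φ.target :=
    fun c ↦ contDiffOn_const
  have h2 : ∀ v w v' w' : Model m, ContDiffOn ℝ ∞ (fun x ↦ half *
      (G.G (φ.symm x) (1 ⊗ₜ coordVec φ x v) (1 ⊗ₜ coordVec φ x w) +
        sgnE A * G.G (φ.symm x) (1 ⊗ₜ coordVec φ x v') (1 ⊗ₜ coordVec φ x w'))) φ.target :=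
    fun v w v' w' ↦ contDiffOn_mul (hc _) ((h _ _).add (contDiffOn_mul (hc _) (h _ _)))
  exact contDiffOn_mul (hc _) ((h2 _ _ _ _).add (contDiffOn_mul (hc _) (h2 _ _ _ _)))

/-- A kernel vector of the matrix gives a tangent vector orthogonal to the spanning set `∂_A`, hence
zero by nondegeneracy. Real finite-dimensionality turns injectivity into surjectivity, and a
surjective matrix over a commutative ring is invertible. -/
theorem isUnit_det_localG (hφ : φ ∈ smoothCharts m M) {x : Model m} (hx : x ∈ φ.target) :
    IsUnit (localG G φ x).det := by
  have hinj : Function.Injective ((localG G φ x).mulVecLin.restrictScalars ℝ) := by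
    rw [injective_iff_map_eq_zero]
    intro v hv
    refine coordC_sum_injective hφ hx ?_
    set Z := ∑ A, v A • coordC φ x A with hZ
    have h0 : ∀ A, G.G (φ.symm x) (coordC φ x A) Z = 0 := by
      intro A
      have := congrFun hv A
      rw [hZ, map_sum]
      simp only [map_smul, smul_eq_mul]
      exact Eq.trans (Finset.sum_congr rfl fun B _ ↦ mul_comm _ _) this
    refine (G.nondegenerate _).2 _ fun W ↦ ?_
    have hW : W ∈ Submodule.span ParaComplex (Set.range (coordC φ x)) := by
      rw [span_coordC hφ hx]; trivial
    induction hW using Submodule.span_induction with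
    | mem W hW => obtain ⟨A, rfl⟩ := hW; exact h0 A
    | zero => simp
    | add W W' _ _ h h' => rw [map_add, LinearMap.add_apply, h, h', add_zero]
    | smul c W _ h => rw [map_smul, LinearMap.smul_apply, h, smul_zero]
  have hs := LinearMap.injective_iff_surjective.1 hinj
  exact (Matrix.isUnit_iff_isUnit_det _).1 (Matrix.mulVec_surjective_iff_isUnit.1 hs)

theorem IC_coordC (hφ : IsParaHolomorphicChart J φ) {x : Model m} (hx : x ∈ φ.target)
    (A : Idx m) : IC J (φ.symm x) (coordC φ x A) = sgnE A • coordC φ x A := by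
  have hI : ∀ v, (J.I (φ.symm x) : RealTangent m (φ.symm x) →ₗ[ℝ] _) (coordVec φ x v) =
    coordVec φ x (e • v) := hφ.2 x hx
  rw [coordC_eq, map_smul, map_add, map_smul, IC, LinearMap.baseChange_tmul,
    LinearMap.baseChange_tmul, hI, hI, e_smul_dirX, e_smul_dirY, smul_comm (sgnE A) half, smul_add (sgnE A),
    smul_smul, sgnE_mul_self, one_smul, add_comm]

theorem localTwin_eq (hφ : IsParaHolomorphicChart J φ) {x : Model m} (hx : x ∈ φ.target)
    (A B : Idx m) : localTwin G φ x A B = sgnE A * localG G φ x A B := by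
  simp only [localTwin, localG, IC_coordC hφ hx, map_smul, LinearMap.smul_apply, smul_eq_mul]

theorem localG_inl_inr (hφ : IsParaHolomorphicChart J φ) {x : Model m} (hx : x ∈ φ.target)
    (a b : Fin m) : localG G φ x (Sum.inl a) (Sum.inr b) = 0 := by
  refine G.orth _ _ _ ?_ ?_
  · exact IC_coordC hφ hx _
  · rw [IC_coordC hφ hx]
    exact neg_smul_tensor e _

theorem localG_inr_inl (hφ : IsParaHolomorphicChart J φ) {x : Model m} (hx : x ∈ φ.target)
    (a b : Fin m) : localG G φ x (Sum.inr a) (Sum.inl b) = 0 := by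
  rw [localG_symm, localG_inl_inr G hφ hx]

end Metric

end ParaGeom

end
noncomputable section

namespace ParaGeom

open ParaComplex TopologicalSpace

variable {m : ℕ} {M : Type*} [TopologicalSpace M] [ChartedSpace (Model m) M]
  [IsManifold 𝓘(ℝ, Model m) ∞ M] {J : ParaComplexStructure m M}
  (G : ParaComplexRiemannianMetric J) {φ : OpenPartialHomeomorph M (Model m)}

/-! ### The characteristic connection in para-holomorphic coordinates -/

/-- The unbarred block of the metric. -/
def localGInl (φ : OpenPartialHomeomorph M (Model m)) (x : Model m) :
    Matrix (Fin m) (Fin m) ParaComplex :=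
  (localG G φ x).toBlocks₁₁

theorem localG_eq_fromBlocks (hφ : IsParaHolomorphicChart J φ) {x : Model m} (hx : x ∈ φ.target) :
    localG G φ x = Matrix.fromBlocks (localGInl G φ x) 0 0 (localG G φ x).toBlocks₂₂ := by
  ext1 A B
  rcases A with a | a <;> rcases B with b | b
  · rfl
  · exact localG_inl_inr G hφ hx a b
  · exact localG_inr_inl G hφ hx a b
  · rfl

theorem isUnit_det_blocks (hφ : IsParaHolomorphicChart J φ) {x : Model m} (hx : x ∈ φ.target) :
    IsUnit (localGInl G φ x).det ∧ IsUnit ((localG G φ x).toBlocks₂₂).det := by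
  have h := isUnit_det_localG G hφ.1 hx
  rw [localG_eq_fromBlocks G hφ hx, Matrix.det_fromBlocks_zero₂₁] at h
  exact IsUnit.mul_iff.1 h

theorem inv_localG (hφ : IsParaHolomorphicChart J φ) {x : Model m} (hx : x ∈ φ.target) :
    (localG G φ x)⁻¹ =
      Matrix.fromBlocks (localGInl G φ x)⁻¹ 0 0 ((localG G φ x).toBlocks₂₂)⁻¹ := by
  obtain ⟨h1, h2⟩ := isUnit_det_blocks G hφ hx
  refine Matrix.inv_eq_right_inv ?_
  nth_rewrite 1 [localG_eq_fromBlocks G hφ hx]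
  rw [Matrix.fromBlocks_multiply, Matrix.mul_nonsing_inv _ h1, Matrix.mul_nonsing_inv _ h2]
  simp

theorem inv_localTwin (hφ : IsParaHolomorphicChart J φ) {x : Model m} (hx : x ∈ φ.target)
    (A B : Idx m) : (localTwin G φ x)⁻¹ A B = (localG G φ x)⁻¹ A B * sgnE B := by
  have h : localTwin G φ x = Matrix.diagonal sgnE * localG G φ x := by
    ext1 A B
    rw [localTwin_eq G hφ hx, Matrix.diagonal_mul]
  have h2 : (localTwin G φ x)⁻¹ = (localG G φ x)⁻¹ * Matrix.diagonal sgnE := by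
    refine Matrix.inv_eq_right_inv ?_
    rw [h, mul_assoc, ← mul_assoc (localG G φ x),
      Matrix.mul_nonsing_inv _ (isUnit_det_localG G hφ.1 hx), one_mul, Matrix.diagonal_mul_diagonal]
    simp [sgnE_mul_self]
  rw [h2, Matrix.mul_diagonal]

/-- Where the two signs differ the component vanishes, and otherwise their product is `1`. A sign
can thus be moved between indices of `G`; the analogues for the inverse and for `dG` serve the same
purpose, replacing case distinctions on index types by ring identities. -/
theorem sgnE_mul_localG (hφ : IsParaHolomorphicChart J φ) {x : Model m} (hx : x ∈ φ.target)
    (A B : Idx m) : sgnE A * (sgnE B * localG G φ x A B) = localG G φ x A B := by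
  rw [← mul_assoc]
  rcases A with a | a <;> rcases B with b | b <;>
    simp [localG_inl_inr G hφ hx, localG_inr_inl G hφ hx, sgnE, e_mul_e]

theorem sgnE_mul_inv_localG (hφ : IsParaHolomorphicChart J φ) {x : Model m} (hx : x ∈ φ.target)
    (A B : Idx m) : sgnE A * (sgnE B * (localG G φ x)⁻¹ A B) = (localG G φ x)⁻¹ A B := by
  rw [← mul_assoc]
  rcases A with a | a <;> rcases B with b | b <;>
    simp [inv_localG G hφ hx, sgnE, e_mul_e]

/-- The derivatives `∂_C G_{AB}`. -/
def dG (φ : OpenPartialHomeomorph M (Model m)) (x : Model m) (A B C : Idx m) : ParaComplex :=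
  pd (fun y ↦ localG G φ y A B) C x

theorem dG_symm (x : Model m) (A B C : Idx m) : dG G φ x A B C = dG G φ x B A C := by
  simp only [dG, localG_symm G _ A B]

theorem differentiableAt_localG (hφ : φ ∈ smoothCharts m M) {x : Model m} (hx : x ∈ φ.target)
    (A B : Idx m) : DifferentiableAt ℝ (fun y ↦ localG G φ y A B) x :=
  ((contDiffOn_localG G hφ A B).differentiableOn (by simp)).differentiableAt
    (φ.open_target.mem_nhds hx)

theorem sgnE_mul_dG (hφ : IsParaHolomorphicChart J φ) {x : Model m} (hx : x ∈ φ.target)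
    (A B C : Idx m) : sgnE A * (sgnE B * dG G φ x A B C) = dG G φ x A B C := by
  rw [dG, ← mul_assoc, ← pd_const_mul _ (differentiableAt_localG G hφ.1 hx A B)]
  exact pd_congr φ.open_target (fun y hy ↦ by rw [mul_assoc, sgnE_mul_localG G hφ hy]) C hx

theorem dG_inl_inr (hφ : IsParaHolomorphicChart J φ) {x : Model m} (hx : x ∈ φ.target)
    (a b : Fin m) (C : Idx m) : dG G φ x (Sum.inl a) (Sum.inr b) C = 0 := by
  rw [dG, ← pd_zero C x]
  exact pd_congr φ.open_target (fun y hy ↦ localG_inl_inr G hφ hy a b) C hx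

theorem dG_inr_inl (hφ : IsParaHolomorphicChart J φ) {x : Model m} (hx : x ∈ φ.target)
    (a b : Fin m) (C : Idx m) : dG G φ x (Sum.inr a) (Sum.inl b) C = 0 := by
  rw [dG_symm, dG_inl_inr G hφ hx]

theorem christoffel_localG (C A B : Idx m) (x : Model m) :
    christoffel (localG G φ) C A B x = half * ∑ D, (localG G φ x)⁻¹ C D *
      (dG G φ x B D A + dG G φ x A D B - dG G φ x A B D) := by
  rw [christoffel, half_smul]
  rfl

theorem christoffel_localTwin (hφ : IsParaHolomorphicChart J φ) {x : Model m} (hx : x ∈ φ.target)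
    (C A B : Idx m) :
    christoffel (localTwin G φ) C A B x = half * ∑ D, (localG G φ x)⁻¹ C D *
      (dG G φ x B D A + dG G φ x A D B - sgnE C * sgnE A * dG G φ x A B D) := by
  have hp : ∀ A B D, pd (fun y ↦ localTwin G φ y A B) D x = sgnE A * dG G φ x A B D := by
    intro A B D
    rw [dG, ← pd_const_mul _ (differentiableAt_localG G hφ.1 hx A B)]
    exact pd_congr φ.open_target (fun y hy ↦ localTwin_eq G hφ hy A B) D hx
  rw [christoffel, half_smul]
  congr 1
  refine Finset.sum_congr rfl fun D _ ↦ ?_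
  rw [hp, hp, hp, inv_localTwin G hφ hx]
  -- Sign bookkeeping: in the first two terms the sign from the twin inverse cancels against the
  -- sign of the twin metric; in the third it is moved from `D` to `C`.
  have h1 := sgnE_mul_dG G hφ hx B D A
  have h2 := sgnE_mul_dG G hφ hx A D B
  have h3 := sgnE_mul_inv_localG G hφ hx C D
  have h4 := sgnE_mul_self C
  linear_combination (localG G φ x)⁻¹ C D * (h1 + h2) - sgnE C * sgnE A * dG G φ x A B D * h3 +
    sgnE A * sgnE D * (localG G φ x)⁻¹ C D * dG G φ x A B D * h4

/-- The two Christoffel symbols differ only in the sign of their last term. The factor `half * (1 -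
sgnE C * sgnE A)` is `0` for indices of equal type and `1` for opposite types, so `Φ` lives on
components such as `Φ^{c̄}_{ab}`. -/
theorem fundPhi_eq (hφ : IsParaHolomorphicChart J φ) {x : Model m} (hx : x ∈ φ.target)
    (C A B : Idx m) :
    fundPhi G φ C A B x =
      half * (1 - sgnE C * sgnE A) * ∑ D, (localG G φ x)⁻¹ C D * dG G φ x A B D := by
  rw [fundPhi, christoffel_localTwin G hφ hx, christoffel_localG, ← mul_sub,
    ← Finset.sum_sub_distrib, mul_assoc]
  congr 1
  rw [Finset.mul_sum]
  exact Finset.sum_congr rfl fun D _ ↦ by ring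

theorem fundPsi_eq (hφ : IsParaHolomorphicChart J φ) {x : Model m} (hx : x ∈ φ.target)
    (A B C : Idx m) :
    fundPsi G φ A B C x = half * (1 - sgnE C * sgnE A) * dG G φ x A B C := by
  have h1 : ∀ D, fundPhi G φ D A B x * localG G φ x D C = half * (1 - sgnE C * sgnE A) *
      ∑ E, localG G φ x C D * (localG G φ x)⁻¹ D E * dG G φ x A B E := by
    intro D
    rw [fundPhi_eq G hφ hx, Finset.mul_sum, Finset.mul_sum, Finset.sum_mul]
    refine Finset.sum_congr rfl fun E _ ↦ ?_
    rw [localG_symm G x D C]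
    -- `G_{CD}` couples only indices of equal type, so `sgnE D` may be replaced by `sgnE C` and
    -- taken out of the sum.
    have h2 := sgnE_mul_localG G hφ hx C D
    have h3 := sgnE_mul_self D
    linear_combination half * (localG G φ x)⁻¹ D E * dG G φ x A B E *
      (sgnE D * sgnE A * h2 - sgnE A * sgnE C * localG G φ x C D * h3)
  have h4 : ∀ E, ∑ D, localG G φ x C D * (localG G φ x)⁻¹ D E =
      (1 : Matrix (Idx m) (Idx m) ParaComplex) C E := fun E ↦ by
    rw [← Matrix.mul_nonsing_inv _ (isUnit_det_localG G hφ.1 hx), Matrix.mul_apply]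
  rw [fundPsi, Finset.sum_congr rfl fun D _ ↦ h1 D, ← Finset.mul_sum, Finset.sum_comm]
  simp only [← Finset.sum_mul, h4]
  simp [Matrix.one_apply]

/-- The two corrections act as indicator functions of index types: the `Φ` term cancels `-∂_D
G_{AB}` when `C` and `A` have opposite types, and the `Ψ` term cancels the first two derivatives
when `A` and `B` do. The vanishing statements below are read off from this form. -/
theorem charConn_eq (hφ : IsParaHolomorphicChart J φ) {x : Model m} (hx : x ∈ φ.target)
    (C A B : Idx m) :
    charConn G φ C A B x = half * ∑ D, (localG G φ x)⁻¹ C D *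
      (dG G φ x B D A + dG G φ x A D B - dG G φ x A B D +
        half * (1 - sgnE C * sgnE A) * dG G φ x A B D -
        half * (1 - sgnE A * sgnE B) * (dG G φ x A D B + dG G φ x B D A)) := by
  rw [charConn, christoffel_localG, fundPhi_eq G hφ hx, half_smul, half_smul, ← mul_add, ← mul_sub,
    Finset.mul_sum, ← Finset.sum_add_distrib, ← Finset.sum_sub_distrib]
  congr 1
  refine Finset.sum_congr rfl fun D _ ↦ ?_
  rw [fundPsi_eq G hφ hx, fundPsi_eq G hφ hx, dG_symm G x D A, dG_symm G x D B]
  have h1 := sgnE_mul_dG G hφ hx A D B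
  have h2 := sgnE_mul_dG G hφ hx B D A
  have h3 := sgnE_mul_self A
  have h4 := sgnE_mul_self B
  linear_combination half * (localG G φ x)⁻¹ C D * (sgnE A * sgnE B * (h1 + h2) -
    sgnE B * sgnE D * dG G φ x A D B * h3 - sgnE A * sgnE D * dG G φ x B D A * h4)

theorem charConn_inl_inl_inl (hφ : IsParaHolomorphicChart J φ) {x : Model m} (hx : x ∈ φ.target)
    (c a b : Fin m) :
    charConn G φ (Sum.inl c) (Sum.inl a) (Sum.inl b) x = (1 / 2 : ℝ) • ∑ d : Fin m,
      (localGInl G φ x)⁻¹ c d * (dG G φ x (Sum.inl b) (Sum.inl d) (Sum.inl a) +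
        dG G φ x (Sum.inl a) (Sum.inl d) (Sum.inl b) -
        dG G φ x (Sum.inl a) (Sum.inl b) (Sum.inl d)) := by
  rw [charConn_eq G hφ hx, inv_localG G hφ hx, half_smul]
  simp [sgnE, e_mul_e]

theorem charConn_inr_inl_inl (hφ : IsParaHolomorphicChart J φ) {x : Model m} (hx : x ∈ φ.target)
    (c a b : Fin m) : charConn G φ (Sum.inr c) (Sum.inl a) (Sum.inl b) x = 0 := by
  rw [charConn_eq G hφ hx, inv_localG G hφ hx]
  simp [sgnE, e_mul_e, dG_inl_inr G hφ hx, mul_add, half_add_half]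

theorem charConn_inr_inr_inl (hφ : IsParaHolomorphicChart J φ) {x : Model m} (hx : x ∈ φ.target)
    (c a b : Fin m) : charConn G φ (Sum.inr c) (Sum.inr a) (Sum.inl b) x = 0 := by
  rw [charConn_eq G hφ hx, inv_localG G hφ hx]
  simp [sgnE, e_mul_e, dG_inl_inr G hφ hx, dG_inr_inl G hφ hx, mul_add, half_add_half]

/-- The trace in `Ric` and the inner sum of the curvature run over all `2m` indices. Each barred
contribution contains a factor, or a derivative, of `L^{c̄}_{ab}` or `L^{c̄}_{āb}`, both zero on the
whole chart. -/
theorem charRic_inl_inl (hφ : IsParaHolomorphicChart J φ) {x : Model m} (hx : x ∈ φ.target)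
    (c a : Fin m) :
    charRic G φ (Sum.inl c) (Sum.inl a) x = ∑ b : Fin m,
      (pd (charConn G φ (Sum.inl b) (Sum.inl b) (Sum.inl c)) (Sum.inl a) x -
        pd (charConn G φ (Sum.inl b) (Sum.inl a) (Sum.inl c)) (Sum.inl b) x +
        ∑ k : Fin m, (charConn G φ (Sum.inl k) (Sum.inl b) (Sum.inl c) x *
            charConn G φ (Sum.inl b) (Sum.inl a) (Sum.inl k) x -
          charConn G φ (Sum.inl k) (Sum.inl a) (Sum.inl c) x *
            charConn G φ (Sum.inl b) (Sum.inl b) (Sum.inl k) x)) := by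
  have h0 : ∀ (h : Model m → ParaComplex) A, (∀ y ∈ φ.target, h y = 0) → pd h A x = 0 :=
    fun h A hh ↦ by rw [← pd_zero A x]; exact pd_congr φ.open_target hh A hx
  rw [charRic, Fintype.sum_sum_type]
  simp only [charCurv, Fintype.sum_sum_type, charConn_inr_inl_inl G hφ hx,
    charConn_inr_inr_inl G hφ hx,
    h0 _ _ (fun y hy ↦ charConn_inr_inl_inl G hφ hy _ _ _),
    h0 _ _ (fun y hy ↦ charConn_inr_inr_inl G hφ hy _ _ _)]
  simp

/-! ### The local form of Schur's lemma -/

/-- The domain of the local components as an open set. -/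
def targetOpens (φ : OpenPartialHomeomorph M (Model m)) : Opens (Model m) :=
  ⟨φ.target, φ.open_target⟩

open FormalMetric in
-- No regularity of `f` is assumed: tracing the Einstein equation expresses `f` through the metric
-- and its derivatives, which makes it smooth and so an element of the algebra to which the formal
-- Schur lemma applies.
theorem local_schur (hm : 3 ≤ m) (hφ : IsParaHolomorphicChart J φ) (f : Model m → ParaComplex)
    (hf : ∀ x ∈ φ.target, ∀ c a : Fin m, charRic G φ (Sum.inl c) (Sum.inl a) x =
      f x * localG G φ x (Sum.inl c) (Sum.inl a)) :
    (∀ x ∈ φ.target, localScal G φ x = (m : ℝ) • f x) ∧ ContDiffOn ℝ ∞ f φ.target ∧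
      ∀ x ∈ φ.target, ∀ a : Fin m, pd f (Sum.inl a) x = 0 := by
  have hm0 : (m : ℝ) ≠ 0 := by positivity
  have hscal : ∀ x ∈ φ.target, localScal G φ x = (m : ℝ) • f x := by
    intro x hx
    have h : ∀ c, ∑ a, (localGInl G φ x)⁻¹ c a * localGInl G φ x a c = 1 := fun c ↦ by
      rw [← Matrix.mul_apply, Matrix.nonsing_inv_mul _ (isUnit_det_blocks G hφ hx).1,
        Matrix.one_apply_eq]
    have h2 : ∀ c a, (localG G φ x)⁻¹ (Sum.inl c) (Sum.inl a) *
        charRic G φ (Sum.inl c) (Sum.inl a) x =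
        f x * ((localGInl G φ x)⁻¹ c a * localGInl G φ x a c) := fun c a ↦ by
      rw [hf x hx, inv_localG G hφ hx, Matrix.fromBlocks_apply₁₁, localG_symm]
      simp only [localGInl, Matrix.toBlocks₁₁, Matrix.of_apply]
      ring
    simp only [localScal, h2, ← Finset.mul_sum, h]
    simp only [Finset.sum_const, Finset.card_univ, Fintype.card_fin, nsmul_eq_mul, mul_one]
    rw [mul_comm, ← nsmul_eq_mul, Nat.cast_smul_eq_nsmul]
  let U := targetOpens φ
  let g : Matrix (Fin m) (Fin m) (smoothFun U) := fun a b ↦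
    smoothFun.mk (fun x ↦ localG G φ x (Sum.inl a) (Sum.inl b)) (contDiffOn_localG G hφ.1 _ _)
  let d : Fin m → Derivation ℝ (smoothFun U) (smoothFun U) := fun a ↦ smoothFun.pd (Sum.inl a)
  have hge : ∀ x : U, g.map (smoothFun.eval x) = localGInl G φ x := fun x ↦ rfl
  obtain ⟨g', hg'⟩ := smoothFun.exists_mul_eq_one g fun x ↦ by
    rw [hge]; exact (isUnit_det_blocks G hφ x.2).1
  have hge' : ∀ x : U, g'.map (smoothFun.eval x) = (localGInl G φ x)⁻¹ := fun x ↦ by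
    refine (Matrix.inv_eq_right_inv ?_).symm
    rw [← hge, ← AlgHom.mapMatrix_apply, ← AlgHom.mapMatrix_apply, ← map_mul, hg', map_one]
  have hge'' : ∀ (x : U) c a, (g' c a).1 x = (localGInl G φ x)⁻¹ c a :=
    fun x c a ↦ congrFun₂ (hge' x) c a
  have hdg : ∀ a b k (x : U), (d k (g a b)).1 x = dG G φ x (Sum.inl a) (Sum.inl b) (Sum.inl k) :=
    fun a b k x ↦ smoothFun.pd_apply _ (fun _ ↦ rfl) x
  have hchris : ∀ a c b (x : U), (chris d g g' a c b).1 x =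
      charConn G φ (Sum.inl c) (Sum.inl a) (Sum.inl b) x := by
    intro a c b x
    rw [charConn_inl_inl_inl G hφ x.2, ← smoothFun.eval_apply]
    simp only [chris, map_smul, map_sum, map_mul, map_add, map_sub]
    simp only [smoothFun.eval_apply, hge'', hdg]
  have hric : ∀ c a (x : U), (∑ b, curv d (chris d g g') a b b c).1 x =
      charRic G φ (Sum.inl c) (Sum.inl a) x := by
    intro c a x
    rw [charRic_inl_inl G hφ x.2, ← smoothFun.eval_apply]
    simp only [curv, map_sum, Matrix.add_apply, Matrix.sub_apply, Matrix.mul_apply,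
      Matrix.map_apply, map_add, map_sub, map_mul]
    simp only [smoothFun.eval_apply, hchris]
    refine Finset.sum_congr rfl fun b _ ↦ ?_
    congr 1
    · congr 1
      · exact smoothFun.pd_apply _ (fun y ↦ hchris _ _ _ y) x
      · exact smoothFun.pd_apply _ (fun y ↦ hchris _ _ _ y) x
    · rw [← Finset.sum_sub_distrib]
      exact Finset.sum_congr rfl fun k _ ↦ by ring
  -- The smooth representative of `f`: the trace of the formal Ricci tensor divided by `m`.
  let F : smoothFun U :=
    (m : ℝ)⁻¹ • ∑ c, ∑ a, g' c a * ∑ b, curv d (chris d g g') a b b c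
  have hF : ∀ x : U, F.1 x = f x := by
    intro x
    have h1 : localScal G φ x = smoothFun.eval x
        (∑ c, ∑ a, g' c a * ∑ b, curv d (chris d g g') a b b c) := by
      simp only [map_sum, map_mul, localScal]
      refine Finset.sum_congr rfl fun c _ ↦ Finset.sum_congr rfl fun a _ ↦ ?_
      rw [← hric, inv_localG G hφ x.2, Matrix.fromBlocks_apply₁₁, ← hge'', ← map_sum]
      rfl
    rw [← smoothFun.eval_apply, map_smul, ← h1, hscal x x.2, smul_smul, inv_mul_cancel₀ hm0,
      one_smul]
  have hFg : ∀ c a, ∑ b, curv d (chris d g g') a b b c = F * g c a := by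
    intro c a
    ext1; funext x
    rw [hric, hf x x.2, ← hF]
    rfl
  have hsymm : g.transpose = g := by
    ext1 a b
    ext1; funext x
    exact localG_symm G x _ _
  refine ⟨hscal, ?_, fun x hx a ↦ ?_⟩
  · exact (show ContDiffOn ℝ ∞ _ _ from F.2).congr fun x hx ↦ by
      rw [extZero_apply _ hx]; exact (hF ⟨x, hx⟩).symm
  · have h := schur (d := d) (fun a b x ↦ smoothFun.pd_comm _ _ x) hsymm hg' F hFg a
    have h2 := congrArg (smoothFun.eval ⟨x, hx⟩) h
    rw [map_mul, map_zero, smoothFun.eval_apply _ (d a F),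
      smoothFun.pd_apply (k := f) _ hF ⟨x, hx⟩] at h2
    -- The coefficient `m - 2` is identified as a real scalar, since a product in `C` may vanish
    -- with both factors nonzero.
    have h3 : smoothFun.eval (⟨x, hx⟩ : U) ((Fintype.card (Fin m) : smoothFun U) - 2) =
        algebraMap ℝ ParaComplex ((m : ℝ) - 2) := by
      rw [map_sub, map_natCast, map_ofNat, map_sub, map_natCast, map_ofNat, Fintype.card_fin]
    rw [h3, ← Algebra.smul_def] at h2
    refine (smul_eq_zero.1 h2).resolve_left ?_
    have : (3 : ℝ) ≤ m := by exact_mod_cast hm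
    linarith

end ParaGeom

end
noncomputable section

namespace ParaGeom

open ParaComplex TopologicalSpace

variable {m : ℕ} {M : Type*} [TopologicalSpace M] [ChartedSpace (Model m) M]

/-! ### Existence of para-holomorphic coordinates -/

/-! ### First integrals, null coordinates and the inverse function theorem. -/

theorem finrank_model : Module.finrank ℝ (Model m) = m + m := by
  rw [Module.finrank_pi_fintype]
  simp [finrank_paraComplex]
  ring

theorem exists_clm_ker_eq (F : Submodule ℝ (Model m)) (hF : Module.finrank ℝ F = m) :
    ∃ l : Model m →L[ℝ] (Fin m → ℝ), ∀ v, l v = 0 ↔ v ∈ F := by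
  have h1 := F.finrank_quotient_add_finrank
  rw [hF, finrank_model] at h1
  have h2 : Module.finrank ℝ (Model m ⧸ F) = Module.finrank ℝ (Fin m → ℝ) := by
    simp only [Module.finrank_fin_fun]
    omega
  refine ⟨LinearMap.toContinuousLinearMap
    ((LinearEquiv.ofFinrankEq _ _ h2).toLinearMap ∘ₗ F.mkQ), fun v ↦ ?_⟩
  simp

/-- Near every point, an integrable distribution of rank `m` is cut out by the differentials of
`m` smooth functions. -/
theorem IsIntegrableDistribution.exists_first_integrals
    {𝒟 : ∀ p : M, Submodule ℝ (RealTangent m p)} (h : IsIntegrableDistribution 𝒟)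
    (hr : ∀ p, Module.finrank ℝ (𝒟 p) = m) (p : M) :
    ∃ O : Set M, IsOpen O ∧ p ∈ O ∧ ∃ u : M → Fin m → ℝ,
      ContMDiffOn 𝓘(ℝ, Model m) 𝓘(ℝ, Fin m → ℝ) ∞ u O ∧
      ∀ q ∈ O, ∀ w : RealTangent m q,
        mfderiv 𝓘(ℝ, Model m) 𝓘(ℝ, Fin m → ℝ) u q w = 0 ↔ w ∈ 𝒟 q := by
  obtain ⟨φ, hφ, hp, F, hF⟩ := h p
  have hφd := mdifferentiable_of_mem_smoothCharts hφ
  have hFr : Module.finrank ℝ F = m := by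
    have hx := φ.map_source hp
    have hb := coordVec_bijective hφ hx
    let c : Model m ≃ₗ[ℝ] RealTangent m (φ.symm (φ p)) :=
      LinearEquiv.ofBijective (coordVecₗ φ (φ p)) hb
    have : F = (𝒟 (φ.symm (φ p))).comap c.toLinearMap := by
      ext v
      exact (hF _ hx v).symm
    rw [this]
    refine ((c.submoduleMap _).finrank_eq.trans ?_).trans (hr (φ.symm (φ p)))
    rw [Submodule.map_comap_eq_of_surjective c.surjective]
  obtain ⟨l, hl⟩ := exists_clm_ker_eq F hFr
  refine ⟨φ.source, φ.open_source, hp, l ∘ φ, ?_, ?_⟩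
  · exact l.contDiff.contMDiff.comp_contMDiffOn (contMDiffOn_of_mem_maximalAtlas hφ)
  · have key : ∀ x ∈ φ.target, ∀ w : RealTangent m (φ.symm x),
        mfderiv 𝓘(ℝ, Model m) 𝓘(ℝ, Fin m → ℝ) (l ∘ φ) (φ.symm x) w = 0 ↔ w ∈ 𝒟 (φ.symm x) := by
      intro x hx w
      obtain ⟨v, rfl⟩ := (coordVec_bijective hφ hx).2 w
      rw [hF x hx, ← hl, mfderiv_comp_apply (I' := 𝓘(ℝ, Model m)) _
        (l.mdifferentiableAt) (hφd.mdifferentiableAt (φ.map_target hx))]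
      have h1 := congrArg (fun L : Model m →L[ℝ] Model m ↦ L v) (hφd.comp_symm_deriv hx)
      have h2 : mfderiv 𝓘(ℝ, Model m) 𝓘(ℝ, Model m) φ (φ.symm x) (coordVec φ x v) = v := h1
      rw [h2, l.mfderiv_eq]
      exact Iff.rfl
    intro q hq
    have := key (φ q) (φ.map_source hq)
    rwa [φ.left_inv hq] at this

/-- The real isomorphism `(u, w) ↦ (1 + e) u + (1 - e) w`. -/
def nullCoord : ((Fin m → ℝ) × (Fin m → ℝ)) →L[ℝ] Model m :=
  LinearMap.toContinuousLinearMap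
    { toFun := fun z a ↦ ⟨z.1 a + z.2 a, z.1 a - z.2 a⟩
      map_add' := fun z w ↦ by
        funext a; ext <;> simp <;> ring
      map_smul' := fun r z ↦ by
        funext a; ext <;> simp <;> ring }

theorem nullCoord_apply (z : (Fin m → ℝ) × (Fin m → ℝ)) (a : Fin m) :
    nullCoord z a = ⟨z.1 a + z.2 a, z.1 a - z.2 a⟩ := rfl

theorem nullCoord_eq_zero {z : (Fin m → ℝ) × (Fin m → ℝ)} (h : nullCoord z = 0) :
    z.1 = 0 ∧ z.2 = 0 := by
  have h1 : ∀ a, z.1 a + z.2 a = 0 := fun a ↦ congrArg QuadraticAlgebra.re (congrFun h a)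
  have h2 : ∀ a, z.1 a - z.2 a = 0 := fun a ↦ congrArg QuadraticAlgebra.im (congrFun h a)
  constructor <;> funext a <;> simp only [Pi.zero_apply] <;> linarith [h1 a, h2 a]

/-- `e (1 + e) = 1 + e` and `e (1 - e) = -(1 - e)`: multiplication by `e` is diagonal in null
coordinates, just as `I` is on `T^+M` and `T^-M`. -/
theorem e_smul_nullCoord (u w : Fin m → ℝ) : e • nullCoord (u, w) = nullCoord (u, -w) := by
  funext a
  ext <;> simp [nullCoord_apply, e]
  ring

/-- The inverse function theorem for `Z` read in a chart; source and target have equal dimension, so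
an injective derivative is invertible. -/
theorem exists_chart_of_mfderiv_injective [IsManifold 𝓘(ℝ, Model m) ∞ M] {O : Set M}
    (hO : IsOpen O) {Z : M → Model m} (hZ : ContMDiffOn 𝓘(ℝ, Model m) 𝓘(ℝ, Model m) ∞ Z O)
    (hinj : ∀ q ∈ O, ∀ v : RealTangent m q,
      mfderiv 𝓘(ℝ, Model m) 𝓘(ℝ, Model m) Z q v = 0 → v = 0) {p : M} (hp : p ∈ O) :
    ∃ φ ∈ smoothCharts m M, p ∈ φ.source ∧ φ.source ⊆ O ∧ ∀ q ∈ φ.source, φ q = Z q := by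
  let ψ := chartAt (Model m) p
  have hψ : ψ ∈ smoothCharts m M := IsManifold.chart_mem_maximalAtlas p
  have hψs := contMDiffOn_symm_of_mem_maximalAtlas hψ
  let W : Set (Model m) := ψ.target ∩ ψ.symm ⁻¹' O
  have hW : IsOpen W := ψ.isOpen_inter_preimage_symm hO
  let H : Model m → Model m := Z ∘ ψ.symm
  have hH : ContDiffOn ℝ ∞ H W := by
    rw [← contMDiffOn_iff_contDiffOn]
    exact hZ.comp (hψs.mono Set.inter_subset_left) fun x hx ↦ hx.2
  have hHat : ∀ x ∈ W, ContDiffAt ℝ ∞ H x := fun x hx ↦ hH.contDiffAt (hW.mem_nhds hx)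
  -- Invertibility is needed throughout `W`, not just at `ψ p`: it makes the local inverse smooth on
  -- its whole domain.
  have hder : ∀ x ∈ W, ∃ L : Model m ≃L[ℝ] Model m, HasFDerivAt H (L : Model m →L[ℝ] Model m) x := by
    intro x hx
    have hd := ((hHat x hx).differentiableAt (by simp)).hasFDerivAt
    have hi : Function.Injective (fderiv ℝ H x).toLinearMap := by
      rw [injective_iff_map_eq_zero]
      intro v hv
      have h1 : fderiv ℝ H x v =
          mfderiv 𝓘(ℝ, Model m) 𝓘(ℝ, Model m) Z (ψ.symm x) (coordVec ψ x v) := by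
        rw [← mfderiv_eq_fderiv]
        exact mfderiv_comp_apply x ((hZ.contMDiffAt (hO.mem_nhds hx.2)).mdifferentiableAt (by simp))
          ((mdifferentiable_of_mem_smoothCharts hψ).mdifferentiableAt_symm hx.1) v
      have h2 := hinj _ hx.2 _ (h1.symm.trans hv)
      refine (coordVec_bijective hψ hx.1).1 (h2.trans ?_)
      exact (map_zero (coordVecₗ ψ x)).symm
    refine ⟨(LinearEquiv.ofInjectiveEndo _ hi).toContinuousLinearEquiv, ?_⟩
    convert! hd
  have hpW : ψ p ∈ W := ⟨ψ.map_source (mem_chart_source _ p), by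
    rw [Set.mem_preimage, ψ.left_inv (mem_chart_source _ p)]; exact hp⟩
  obtain ⟨L, hL⟩ := hder _ hpW
  let h := ((hHat _ hpW).toOpenPartialHomeomorph H hL (by simp)).restrOpen W hW
  have hhs : h.source ⊆ W := fun x hx ↦ hx.2
  have hhsymm : ContDiffOn ℝ ∞ h.symm h.target := by
    intro y hy
    have hyW := hhs (h.map_target hy)
    obtain ⟨L', hL'⟩ := hder _ hyW
    exact (h.contDiffAt_symm hy hL' (hHat _ hyW)).contDiffWithinAt
  let φ : OpenPartialHomeomorph M (Model m) := ψ.trans h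
  have hφZ : ∀ q ∈ φ.source, φ q = Z q := fun q hq ↦
    congrArg Z (ψ.left_inv (ψ.trans_source h ▸ hq).1)
  have hφO : φ.source ⊆ O := fun q hq ↦ by
    have h1 := (ψ.trans_source h ▸ hq)
    have h2 := (hhs h1.2).2
    rwa [Set.mem_preimage, ψ.left_inv h1.1] at h2
  refine ⟨φ, φ.mem_maximalAtlas_of_contMDiffOn ((hZ.mono hφO).congr hφZ) ?_, ?_, hφO, hφZ⟩
  · have h1 : ContMDiffOn 𝓘(ℝ, Model m) 𝓘(ℝ, Model m) ∞ h.symm h.target :=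
      contMDiffOn_iff_contDiffOn.2 hhsymm
    have h2 : φ.target ⊆ h.target := fun y hy ↦ (ψ.trans_target h ▸ hy).1
    exact hψs.comp (h1.mono h2) fun y hy ↦ (ψ.trans_target h ▸ hy).2
  · rw [ψ.trans_source h]
    exact ⟨mem_chart_source _ p, ContDiffAt.mem_toOpenPartialHomeomorph_source _ _ _, hpW⟩

section

variable [IsManifold 𝓘(ℝ, Model m) ∞ M] (J : ParaComplexStructure m M)

/-- `v = ½(v + Iv) + ½(v - Iv)` splits the tangent space into the two eigenspaces, whose dimensions
are equal and add up to `2m`. -/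
theorem ParaComplexStructure.finrank_eigenspaces (p : M) :
    Module.finrank ℝ (LinearMap.ker (LinearMap.id - (J.I p : RealTangent m p →ₗ[ℝ] _))) = m ∧
    Module.finrank ℝ (LinearMap.ker (LinearMap.id + (J.I p : RealTangent m p →ₗ[ℝ] _))) = m := by
  have hsq : ∀ v, J.I p (J.I p v) = v := J.sq p
  have hc : IsCompl (LinearMap.ker (LinearMap.id - (J.I p : RealTangent m p →ₗ[ℝ] _)))
      (LinearMap.ker (LinearMap.id + (J.I p : RealTangent m p →ₗ[ℝ] _))) := by
    constructor
    · rw [Submodule.disjoint_def]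
      intro v h1 h2
      have h1' : v - J.I p v = 0 := h1
      have h2' : v + J.I p v = 0 := h2
      have h3 : (2 : ℝ) • v = (v - J.I p v) + (v + J.I p v) := by module
      rw [h1', h2', add_zero] at h3
      exact (smul_eq_zero.1 h3).resolve_left two_ne_zero
    · rw [codisjoint_iff, eq_top_iff]
      intro v _
      rw [Submodule.mem_sup]
      refine ⟨(1 / 2 : ℝ) • (v + J.I p v), ?_, (1 / 2 : ℝ) • (v - J.I p v), ?_, by module⟩
      · change (1 / 2 : ℝ) • (v + J.I p v) - J.I p ((1 / 2 : ℝ) • (v + J.I p v)) = 0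
        rw [map_smul, map_add, hsq]
        module
      · change (1 / 2 : ℝ) • (v - J.I p v) + J.I p ((1 / 2 : ℝ) • (v - J.I p v)) = 0
        rw [map_smul, map_sub, hsq]
        module
  have hf : FiniteDimensional ℝ (RealTangent m p) :=
    inferInstanceAs (FiniteDimensional ℝ (Model m))
  have h1 := Submodule.finrank_add_eq_of_isCompl hc
  have h2 : Module.finrank ℝ (RealTangent m p) = m + m := finrank_model
  have h3 := J.finrank_eq p
  omega

/-- Take `u` with `ker du = T^-M` and `w` with `ker dw = T^+M`. Since `Iv - v` lies in `T^-M` and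
`Iv + v` in `T^+M`, one has `du ∘ I = du` and `dw ∘ I = -dw`, so `Z = (1 + e) u + (1 - e) w`
satisfies `dZ ∘ I = e dZ`. It is a local diffeomorphism because `T^+M ∩ T^-M = 0`. -/
theorem ParaComplexStructure.exists_paraHolomorphicChart (p : M) :
    ∃ φ : OpenPartialHomeomorph M (Model m), IsParaHolomorphicChart J φ ∧ p ∈ φ.source := by
  obtain ⟨O₁, hO₁, hp₁, u, hu, hud⟩ := J.integrable_minus.exists_first_integrals
    (fun q ↦ (J.finrank_eigenspaces q).2) p
  obtain ⟨O₂, hO₂, hp₂, w, hw, hwd⟩ := J.integrable_plus.exists_first_integrals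
    (fun q ↦ (J.finrank_eigenspaces q).1) p
  have hO := hO₁.inter hO₂
  let Z : M → Model m := fun q ↦ nullCoord (u q, w q)
  have hZ : ContMDiffOn 𝓘(ℝ, Model m) 𝓘(ℝ, Model m) ∞ Z (O₁ ∩ O₂) :=
    nullCoord.contDiff.contMDiff.comp_contMDiffOn
      ((hu.mono Set.inter_subset_left).prodMk_space (hw.mono Set.inter_subset_right))
  have hdZ : ∀ q ∈ O₁ ∩ O₂, ∀ v : RealTangent m q,
      mfderiv 𝓘(ℝ, Model m) 𝓘(ℝ, Model m) Z q v =
        nullCoord (mfderiv 𝓘(ℝ, Model m) 𝓘(ℝ, Fin m → ℝ) u q v,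
          mfderiv 𝓘(ℝ, Model m) 𝓘(ℝ, Fin m → ℝ) w q v) := by
    intro q hq v
    have hu' := ((hu.contMDiffAt (hO₁.mem_nhds hq.1)).mdifferentiableAt (by simp)).hasMFDerivAt
    have hw' := ((hw.contMDiffAt (hO₂.mem_nhds hq.2)).mdifferentiableAt (by simp)).hasMFDerivAt
    have hp : HasMFDerivAt 𝓘(ℝ, Model m) 𝓘(ℝ, (Fin m → ℝ) × (Fin m → ℝ)) (fun q ↦ (u q, w q)) q
        (ContinuousLinearMap.prod (mfderiv 𝓘(ℝ, Model m) 𝓘(ℝ, Fin m → ℝ) u q : Model m →L[ℝ] _)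
          (mfderiv 𝓘(ℝ, Model m) 𝓘(ℝ, Fin m → ℝ) w q : Model m →L[ℝ] _)) :=
      ⟨hu'.1.prodMk hw'.1, hu'.2.prodMk hw'.2⟩
    have h := nullCoord.hasMFDerivAt.comp q hp
    exact congrArg (fun L : Model m →L[ℝ] Model m ↦ L v) h.mfderiv
  have hu0 : ∀ q ∈ O₁ ∩ O₂, ∀ v : RealTangent m q,
      mfderiv 𝓘(ℝ, Model m) 𝓘(ℝ, Fin m → ℝ) u q (J.I q v) =
        mfderiv 𝓘(ℝ, Model m) 𝓘(ℝ, Fin m → ℝ) u q v := by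
    intro q hq v
    rw [← sub_eq_zero, ← map_sub]
    refine (hud q hq.1 _).2 ?_
    change (J.I q v - v) + J.I q (J.I q v - v) = 0
    rw [map_sub, J.sq]
    abel
  have hw0 : ∀ q ∈ O₁ ∩ O₂, ∀ v : RealTangent m q,
      mfderiv 𝓘(ℝ, Model m) 𝓘(ℝ, Fin m → ℝ) w q (J.I q v) =
        -mfderiv 𝓘(ℝ, Model m) 𝓘(ℝ, Fin m → ℝ) w q v := by
    intro q hq v
    rw [eq_neg_iff_add_eq_zero, ← map_add]
    refine (hwd q hq.2 _).2 ?_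
    change (J.I q v + v) - J.I q (J.I q v + v) = 0
    rw [map_add, J.sq]
    abel
  obtain ⟨φ, hφ, hpφ, hφO, hφZ⟩ := exists_chart_of_mfderiv_injective hO hZ (fun q hq v hv ↦ by
    rw [hdZ q hq] at hv
    obtain ⟨h1, h2⟩ := nullCoord_eq_zero hv
    have h3 : v + J.I q v = 0 := (hud q hq.1 v).1 h1
    have h4 : v - J.I q v = 0 := (hwd q hq.2 v).1 h2
    have h5 : (2 : ℝ) • v = (v - J.I q v) + (v + J.I q v) := by module
    rw [h3, h4, add_zero] at h5
    exact (smul_eq_zero.1 h5).resolve_left two_ne_zero) (show p ∈ O₁ ∩ O₂ from ⟨hp₁, hp₂⟩)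
  refine ⟨φ, ⟨hφ, fun x hx v ↦ ?_⟩, hpφ⟩
  have hφd := mdifferentiable_of_mem_smoothCharts hφ
  have hq := φ.map_target hx
  have hdφ : mfderiv 𝓘(ℝ, Model m) 𝓘(ℝ, Model m) φ (φ.symm x) =
      mfderiv 𝓘(ℝ, Model m) 𝓘(ℝ, Model m) Z (φ.symm x) :=
    Filter.EventuallyEq.mfderiv_eq
      (Filter.eventuallyEq_of_mem (φ.open_source.mem_nhds hq) hφZ)
  have hinv : ∀ v, mfderiv 𝓘(ℝ, Model m) 𝓘(ℝ, Model m) φ (φ.symm x) (coordVec φ x v) = v :=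
    fun v ↦ congrArg (fun L : Model m →L[ℝ] Model m ↦ L v) (hφd.comp_symm_deriv hx)
  apply hφd.mfderiv_injective hq
  refine Eq.trans ?_ (hinv (e • v)).symm
  have h1 := hdZ _ (hφO hq) (J.I (φ.symm x) (coordVec φ x v))
  rw [hu0 _ (hφO hq), hw0 _ (hφO hq)] at h1
  replace h1 := h1.trans (e_smul_nullCoord _ _).symm
  rw [← hdZ _ (hφO hq)] at h1
  rw [hdφ]
  refine h1.trans ?_
  have h2 := hinv v
  rw [hdφ] at h2
  exact congrArg (e • ·) h2

end

/-! ### The characteristic scalar curvature -/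

section

variable [IsManifold 𝓘(ℝ, Model m) ∞ M] {J : ParaComplexStructure m M}

/-- A function which is smooth with vanishing `∂/∂z^a` in all para-holomorphic coordinates is
anti-para-holomorphic. -/
theorem isAntiParaHolomorphic_of_local {h : M → ParaComplex}
    (hh : ∀ φ : OpenPartialHomeomorph M (Model m), IsParaHolomorphicChart J φ →
      ContDiffOn ℝ ∞ (h ∘ φ.symm) φ.target ∧
        ∀ x ∈ φ.target, ∀ a : Fin m, pd (h ∘ φ.symm) (Sum.inl a) x = 0) :
    IsAntiParaHolomorphic J h := by
  have hsm : ContMDiff 𝓘(ℝ, Model m) 𝓘(ℝ, ParaComplex) ∞ h := by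
    intro p
    obtain ⟨φ, hφ, hp⟩ := J.exists_paraHolomorphicChart p
    have h1 : ContMDiffOn 𝓘(ℝ, Model m) 𝓘(ℝ, ParaComplex) ∞ (h ∘ φ.symm) φ.target :=
      contMDiffOn_iff_contDiffOn.2 (hh φ hφ).1
    have h2 : ContMDiffOn 𝓘(ℝ, Model m) 𝓘(ℝ, ParaComplex) ∞ ((h ∘ φ.symm) ∘ φ) φ.source :=
      h1.comp (contMDiffOn_of_mem_maximalAtlas hφ.1) fun q hq ↦ φ.map_source hq
    exact (h2.congr fun q hq ↦ by
      simp only [Function.comp_apply, φ.left_inv hq]).contMDiffAt (φ.open_source.mem_nhds hp)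
  refine ⟨hsm, fun p ↦ ?_⟩
  obtain ⟨φ, hφ, hp⟩ := J.exists_paraHolomorphicChart p
  have key : ∀ x ∈ φ.target, ∀ v : RealTangent m (φ.symm x),
      dfun h (φ.symm x) (J.I (φ.symm x) v) = -(e * dfun h (φ.symm x) v) := by
    intro x hx v
    obtain ⟨v, rfl⟩ := (coordVec_bijective hφ.1 hx).2 v
    have hd : ∀ v, dfun h (φ.symm x) (coordVec φ x v) = fderiv ℝ (h ∘ φ.symm) x v := fun v ↦ by
      rw [← mfderiv_eq_fderiv]
      exact (mfderiv_comp_apply x (hsm.mdifferentiableAt (by simp))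
        ((mdifferentiable_of_mem_smoothCharts hφ.1).mdifferentiableAt_symm hx) v).symm
    rw [hφ.2 x hx, hd, hd]
    -- `∂_a h = 0` is this relation; multiplying by `e` gives its counterpart `hY`, and real
    -- linearity extends the two to all directions.
    have hX : ∀ a, fderiv ℝ (h ∘ φ.symm) x (dirX a) =
        -(e * fderiv ℝ (h ∘ φ.symm) x (dirY a)) := fun a ↦
      eq_neg_of_add_eq_zero_left
        ((smul_eq_zero.1 ((hh φ hφ).2 x hx a)).resolve_left (by norm_num))
    have hY : ∀ a, fderiv ℝ (h ∘ φ.symm) x (dirY a) =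
        -(e * fderiv ℝ (h ∘ φ.symm) x (dirX a)) := fun a ↦ by
      rw [hX, mul_neg, ← mul_assoc, e_mul_e, one_mul, neg_neg]
    rw [model_eq_sum v, Finset.smul_sum, map_sum, map_sum, Finset.mul_sum,
      ← Finset.sum_neg_distrib]
    refine Finset.sum_congr rfl fun a _ ↦ ?_
    rw [smul_add, smul_comm e, smul_comm e, e_smul_dirX, e_smul_dirY, map_add, map_add, map_smul,
      map_smul, map_smul, map_smul, mul_add, mul_smul_comm, mul_smul_comm, neg_add, ← smul_neg,
      ← smul_neg, ← hX, ← hY]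
  have := key (φ p) (φ.map_source hp)
  rwa [φ.left_inv hp] at this

/-- Existence of charts excludes the default value `0`, and a chart-independent local value makes
the choice of chart irrelevant. -/
theorem charScal_eq_of_forall_localScal (G : ParaComplexRiemannianMetric J) {h : M → ParaComplex}
    (hh : ∀ φ : OpenPartialHomeomorph M (Model m), IsParaHolomorphicChart J φ →
      ∀ x ∈ φ.target, localScal G φ x = h (φ.symm x)) : charScal G = h := by
  funext p
  have hex := J.exists_paraHolomorphicChart p
  rw [charScal, dif_pos hex, hh _ hex.choose_spec.1 _ (hex.choose.map_source hex.choose_spec.2),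
    hex.choose.left_inv hex.choose_spec.2]

end

end ParaGeom

end

theorem mainTheorem9 {m : ℕ} (hm : 3 ≤ m) {M : Type*} [TopologicalSpace M]
    [ChartedSpace (ParaGeom.Model m) M] [IsManifold 𝓘(ℝ, ParaGeom.Model m) ∞ M]
    (J : ParaGeom.ParaComplexStructure m M) (G : ParaGeom.ParaComplexRiemannianMetric J)
    (hG : ParaGeom.IsCharacteristicEinstein G) :
    (∀ φ : OpenPartialHomeomorph M (ParaGeom.Model m), ParaGeom.IsParaHolomorphicChart J φ →
      ∀ x ∈ φ.target, ParaGeom.charScal G (φ.symm x) =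
        ∑ c : Fin m, ∑ a : Fin m,
          (ParaGeom.localG G φ x)⁻¹ (Sum.inl c) (Sum.inl a) *
            ParaGeom.charRic G φ (Sum.inl c) (Sum.inl a) x) ∧
    ParaGeom.IsAntiParaHolomorphic J (ParaGeom.charScal G) ∧
    (∀ φ : OpenPartialHomeomorph M (ParaGeom.Model m), ParaGeom.IsParaHolomorphicChart J φ →
      ∀ x ∈ φ.target, ∀ c a : Fin m,
        ParaGeom.charRic G φ (Sum.inl c) (Sum.inl a) x =
          ((1 / (m : ℝ)) • ParaGeom.charScal G (φ.symm x)) *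
            ParaGeom.localG G φ x (Sum.inl c) (Sum.inl a)) := by
  obtain ⟨f, hf⟩ := hG
  have hloc := fun (φ : OpenPartialHomeomorph M (ParaGeom.Model m))
      (hφ : ParaGeom.IsParaHolomorphicChart J φ) ↦
    ParaGeom.local_schur G hm hφ (f ∘ φ.symm) fun x hx c a ↦ (hf φ hφ x hx c a).2
  -- The Einstein function is global, so `m f` is the common value of the local traces; all three
  -- claims now concern `f`.
  have hscal : ParaGeom.charScal G = fun p ↦ (m : ℝ) • f p :=
    ParaGeom.charScal_eq_of_forall_localScal G fun φ hφ x hx ↦ (hloc φ hφ).1 x hx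
  refine ⟨fun φ hφ x hx ↦ ?_, ?_, fun φ hφ x hx c a ↦ ?_⟩
  · rw [hscal]
    exact ((hloc φ hφ).1 x hx).symm
  · rw [hscal]
    refine ParaGeom.isAntiParaHolomorphic_of_local fun φ hφ ↦ ?_
    obtain ⟨-, h1, h2⟩ := hloc φ hφ
    refine ⟨h1.const_smul (m : ℝ), fun x hx a ↦ ?_⟩
    have h3 : (fun p ↦ (m : ℝ) • f p) ∘ φ.symm =
        fun x ↦ algebraMap ℝ ParaGeom.ParaComplex m * (f ∘ φ.symm) x := by
      funext x
      exact Algebra.smul_def _ _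
    rw [h3, ParaGeom.pd_const_mul _ ((h1.differentiableOn (by simp)).differentiableAt
      (φ.open_target.mem_nhds hx)), h2 x hx a, mul_zero]
  · have hm0 : (m : ℝ) ≠ 0 := by positivity
    rw [(hf φ hφ x hx c a).2, hscal, smul_smul, one_div, inv_mul_cancel₀ hm0, one_smul]
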